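/- Circuits consist of arbitrary single-qubit unitaries and CNOT gates (all exact), and their cost is the number of CNOTs. A circuit on $n$ system qubits, $c$ clean and $d$ dirty ancillas implements an isometry $V$ from $m$ to $n$ qubits ($m\le n$; a gate if $m=n$) if it maps $|0\rangle_{n-m}|x\rangle_m\otimes|0\rangle_c\otimes|y\rangle_d$ to $V|x\rangle\otimes|0\rangle_c\otimes|y\rangle_d$ for all basis states $x,y$. Let $I_{n,m}$ be the first $2^m$ columns of the identity on $n$ qubits. For given ancillas $(c,d)$ define, as least CNOT numbers in $\mathbb N\cup\{\infty\}$ that suffice in the worst case: - $\mathcal N_{\Pi I\Delta}^{c,d}(n,m)$: implementing every isometry $\Pi_n I_{n,m}\Delta_m$, where $\Pi_n$ is a permutation gate (of the computational basis states) on $n$ qubits and $\Delta_m$ a diagonal unitary on $m$ qubits; - $\mathcal N_{\mathrm{Piv}}^{\Delta,c,d}(n,s)$: for every state $|v\rangle$ on $n$ qubits with at most $2^s$ non-zero entries, implementing $\Delta\,\mathrm{Piv}_v$ for some diagonal gate $\Delta$ and some permutation gate $\mathrm{Piv}_v$ with $\mathrm{Piv}_v|v\rangle=|i\rangle_{n-s}\otimes|\tilde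 v\rangle_s$ for a basis state $|i\rangle$ and an $s$-qubit state $|\tilde v\rangle$; - $\mathcal N_{\Pi}^{\Delta,c,d}(m)$: for every permutation gate $\Pi_m$ on $m$ qubits, implementing $\Delta\Pi_m$ for some diagonal gate $\Delta$; - $\mathcal N_{\Delta}^{c,d}(m)$: implementing every diagonal gate on $m$ qubits. Lemma. Let $m\le n$. 1. For all $c,d\ge 0$, $$\mathcal N_{\Pi I\Delta}^{c,d}(n,m)\le \mathcal N_{\mathrm{Piv}}^{\Delta,c,d}(n,m)+\mathcal N_{\Pi}^{\Delta,c+n-m,d}(m)+\mathcal N_{\Delta}^{c+n-m,d}(m),$$ where the gates on $m$ qubits may also use the $n-m$ remaining system qubits, which are in the state $|0\rangle$. 2. If $m\ge 1$, every isometry $\Pi_n I_{n,m}\Delta_m$ can be implemented with at most $(n+34m-34)2^m$ CNOTs without ancilla, or with one dirty ancilla in the case $m=n-1$. 3. If $m\ge 2$, every isometry $\Pi_n I_{n,m}\Delta_m$ can be implemented with at most $(n+24m-32)2^m$ CNOTs with $\lceil \frac m2-1\rceil$ clean ancillas. -/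

import Mathlib

open scoped Matrix

/-! ### Circuits of single-qubit gates and CNOT gates

The computational basis states of a register whose wires are labelled by `ι` are the bit
strings `ι → Bool`. On `n` qubits the wires are `Fin n`, and wire `i` carries the binary digit of
weight `2 ^ i` of the index of a basis state. -/

/-- An elementary gate: an arbitrary single-qubit unitary, or a CNOT with distinct control and
target. -/
inductive QGate (ι : Type) : Type
  | single (i : ι) (U : Matrix.unitaryGroup Bool ℂ) : QGate ι
  | cnot (control target : ι) (h : control ≠ target) : QGate ι

/-- The unitary matrix of an elementary gate, acting on the whole register. -/
def QGate.matrix {ι : Type} [Fintype ι] [DecidableEq ι] :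
    QGate ι → Matrix (ι → Bool) (ι → Bool) ℂ
  | .single i U => Matrix.of fun a b =>
      if ∀ j, j ≠ i → a j = b j then (U : Matrix Bool Bool ℂ) (a i) (b i) else 0
  | .cnot c t _ => Matrix.of fun a b =>
      if a = Function.update b t (xor (b t) (b c)) then 1 else 0

/-- A circuit is a list of elementary gates; the head of the list is applied first. -/
abbrev QCircuit (ι : Type) : Type := List (QGate ι)

/-- The unitary matrix of a circuit. -/
def QCircuit.matrix {ι : Type} [Fintype ι] [DecidableEq ι] :
    QCircuit ι → Matrix (ι → Bool) (ι → Bool) ℂ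
  | [] => 1
  | g :: l => QCircuit.matrix l * g.matrix

/-- The number of CNOT gates of a circuit. -/
def QCircuit.cnotCount {ι : Type} : QCircuit ι → ℕ
  | [] => 0
  | .single _ _ :: l => QCircuit.cnotCount l
  | .cnot _ _ _ :: l => QCircuit.cnotCount l + 1

/-! ### Gates, isometries and states -/

/-- The basis state `|0⟩_{n-m} ⊗ |x⟩_m` of `n` qubits: the basis state of `n` qubits which has the
same index (a number less than `2 ^ m`) as `x`. -/
def padZero {m : ℕ} (n : ℕ) (x : Fin m → Bool) : Fin n → Bool :=
  fun i => if h : (i : ℕ) < m then x ⟨i, h⟩ else false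

/-- `I_{n,m}`: the first `2 ^ m` columns of the identity on `n` qubits. -/
def idIsometry (n m : ℕ) : Matrix (Fin n → Bool) (Fin m → Bool) ℂ :=
  Matrix.of fun a x => if a = padZero n x then 1 else 0

/-- The permutation gate on `n` qubits given by a permutation of the basis states. -/
def permGate {n : ℕ} (σ : Equiv.Perm (Fin n → Bool)) : Matrix (Fin n → Bool) (Fin n → Bool) ℂ :=
  σ.permMatrix ℂ

/-- The diagonal gate on `n` qubits with the given phases. -/
noncomputable def diagGate {n : ℕ} (δ : (Fin n → Bool) → Circle) :
    Matrix (Fin n → Bool) (Fin n → Bool) ℂ :=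
  Matrix.diagonal fun a => (δ a : ℂ)

/-- A (pure) state on `n` qubits: a unit vector. -/
def IsState {n : ℕ} (v : (Fin n → Bool) → ℂ) : Prop := ∑ a, ‖v a‖ ^ 2 = 1

/-- The number of non-zero entries in the computational basis. -/
noncomputable def nnz {n : ℕ} (v : (Fin n → Bool) → ℂ) : ℕ := {a | v a ≠ 0}.ncard

/-- The vector `|i⟩_{n-s} ⊗ |w⟩_s` on `n` qubits; the `s` least significant qubits carry `w`. -/
def blockVec {n s : ℕ} (hs : s ≤ n) (i : Fin (n - s) → Bool) (w : (Fin s → Bool) → ℂ) :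
    (Fin n → Bool) → ℂ :=
  fun a => if (∀ k : Fin (n - s), a ⟨s + k, by omega⟩ = i k)
    then w (fun k => a (Fin.castLE hs k)) else 0

/-- The permutation gate of `σ` pivots `v`: it disentangles the `n - s` most significant qubits
in a computational basis state. -/
def Pivots {n s : ℕ} (hs : s ≤ n) (σ : Equiv.Perm (Fin n → Bool)) (v : (Fin n → Bool) → ℂ) :
    Prop :=
  ∃ (i : Fin (n - s) → Bool) (w : (Fin s → Bool) → ℂ),
    IsState w ∧ permGate σ *ᵥ v = blockVec hs i w

/-! ### CNOT counts

The register consists of `n` system qubits, `c` clean ancillas (which start in `|0⟩` and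
are restored to `|0⟩`) and `d` dirty ancillas (which start in an arbitrary state and are restored
to it). -/

/-- The wires of a register with `n` system qubits, `c` clean and `d` dirty ancillas. -/
abbrev Wires (n c d : ℕ) : Type := Fin n ⊕ (Fin c ⊕ Fin d)

/-- The basis state `|a⟩|z⟩|y⟩` of the register. -/
def joinBits {n c d : ℕ} (a : Fin n → Bool) (z : Fin c → Bool) (y : Fin d → Bool) :
    Wires n c d → Bool :=
  Sum.elim a (Sum.elim z y)

/-- The circuit `C` implements `V`, an isometry from `m` to `n` qubits (a unitary if `m = n`), with
`c` clean and `d` dirty ancillas: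
`C (|0⟩_{n-m} |x⟩_m ⊗ |0⟩_c ⊗ |y⟩_d) = V |x⟩ ⊗ |0⟩_c ⊗ |y⟩_d` for all basis states `x` and `y`. -/
def Implements {n m : ℕ} (c d : ℕ) (C : QCircuit (Wires n c d))
    (V : Matrix (Fin n → Bool) (Fin m → Bool) ℂ) : Prop :=
  ∀ (x : Fin m → Bool) (y : Fin d → Bool)
    (a : Fin n → Bool) (z : Fin c → Bool) (w : Fin d → Bool),
    C.matrix (joinBits a z w) (joinBits (padZero n x) (fun _ => false) y) =
      if z = (fun _ => false) ∧ w = y then V a x else 0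

/-- The least number of CNOTs of a circuit which implements `V` with `c` clean and `d` dirty
ancillas (`⊤` if there is no such circuit). -/
noncomputable def cnotCost {n m : ℕ} (c d : ℕ) (V : Matrix (Fin n → Bool) (Fin m → Bool) ℂ) : ℕ∞ :=
  ⨅ (C : QCircuit (Wires n c d)) (_ : Implements c d C V), (C.cnotCount : ℕ∞)

/-- `N_Δ(m)`: the number of CNOTs that suffices for every diagonal gate on `m` qubits. -/
noncomputable def costDiag (c d m : ℕ) : ℕ∞ :=
  ⨆ δ : (Fin m → Bool) → Circle, cnotCost c d (diagGate δ)

/-- `N_Π^Δ(m)`: the number of CNOTs that suffices for every permutation gate on `m` qubits up to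
a diagonal gate. -/
noncomputable def costPermUpToDiag (c d m : ℕ) : ℕ∞ :=
  ⨆ σ : Equiv.Perm (Fin m → Bool), ⨅ δ : (Fin m → Bool) → Circle,
    cnotCost c d (diagGate δ * permGate σ)

/-- `N_Piv^Δ(n,s)`: the number of CNOTs that suffices for pivoting, up to a diagonal gate, every
state on `n` qubits with at most `2 ^ s` non-zero entries. -/
noncomputable def costPivUpToDiag (c d : ℕ) {n s : ℕ} (hs : s ≤ n) : ℕ∞ :=
  ⨆ (v : (Fin n → Bool) → ℂ) (_ : IsState v) (_ : nnz v ≤ 2 ^ s),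
    ⨅ (σ : Equiv.Perm (Fin n → Bool)) (_ : Pivots hs σ v) (δ : (Fin n → Bool) → Circle),
      cnotCost c d (diagGate δ * permGate σ)

/-- `N_{ΠIΔ}(n,m)`: the number of CNOTs that suffices for every permuted diagonal isometry
`Π_n I_{n,m} Δ_m` from `m` to `n` qubits. -/
noncomputable def costPermDiagIsometry (c d n m : ℕ) : ℕ∞ :=
  ⨆ (σ : Equiv.Perm (Fin n → Bool)) (δ : (Fin m → Bool) → Circle),
    cnotCost c d (permGate σ * idIsometry n m * diagGate δ)

/-! Everything rests on maps of basis states that circuits realise up to phases (`Reachable`): such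
maps compose and invert with CNOT counts under control, and the phases are repaired once, at the
end, by one diagonal gate on the `m` input qubits.

Three constructions supply the costs. A uniformly controlled rotation with `k` controls takes `2 ^ k
- 1` CNOTs if one CNOT is left over (`exists_circuit_rotation`); about the `y`-axis this gives
arbitrarily controlled flips up to phases, about the `z`-axis diagonal gates with `2 ^ m - 2` CNOTs.
A permutation of `k`-bit strings is a product of `2 * k - 1` controlled flips, by peeling off one
wire at a time with a 2-colouring (`reachable_perm_of_fixes`). A flip with many controls costs
linearly many CNOTs when dirty wires are available (`reachable_toggle_dirty`,
`reachable_toggle_one_dirty`).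

The inequality between costs comes from running a pivoting circuit backwards: pivoting the uniform
superposition of the columns' basis states moves all of them into one block, where only a
permutation and a diagonal gate on `m` qubits remain.

The explicit bounds are proved directly. If `n ≤ m + 1`, the whole permutation on `n` qubits is
synthesised. Otherwise the `2 ^ m` image states are moved one by one into the subspace where only
the low `m` wires may be nonzero (`exists_pivot`), each by a fan-out of CNOTs and one flip with `m`
controls; a permutation of the low wires followed by the inverse of this pivot is the required map.
-/

/-! ### Block matrices acting on one wire -/

section Circuits

variable {ι κ : Type} [Fintype ι] [DecidableEq ι] [Fintype κ] [DecidableEq κ]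

/-- The matrix which applies to the wire `t` the block `B b` chosen by the basis state `b`. -/
def muxMatrix (t : ι) (B : (ι → Bool) → Matrix Bool Bool ℂ) :
    Matrix (ι → Bool) (ι → Bool) ℂ :=
  Matrix.of fun a b => if ∀ j, j ≠ t → a j = b j then B b (a t) (b t) else 0

/-- The power `X ^ s` of the Pauli matrix `X`. -/
def pauliXPow (s : Bool) : Matrix Bool Bool ℂ :=
  Matrix.of fun i j => if i = xor j s then 1 else 0

/-- Only intermediate states that differ from `b` at most in the wire `t` contribute to the product,
and `hA` says that `A` selects the same block at both of them. -/
theorem muxMatrix_mul (t : ι) (A B : (ι → Bool) → Matrix Bool Bool ℂ)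
    (hA : ∀ b v, A (Function.update b t v) = A b) :
    muxMatrix t A * muxMatrix t B = muxMatrix t fun b => A b * B b := by
  ext a b
  simp only [Matrix.mul_apply, muxMatrix, Matrix.of_apply]
  rw [← Fintype.sum_of_injective (fun v : Bool => Function.update b t v)
    (Function.update_injective b t)
    (fun v => if ∀ j, j ≠ t → a j = b j then A b (a t) v * B b v (b t) else 0)]
  · split_ifs <;> simp
  · intro c hc
    have : ¬ ∀ j, j ≠ t → c j = b j := by
      intro h
      refine hc ⟨c t, ?_⟩
      ext j
      by_cases hj : j = t
      · subst hj; simp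
      · simp [hj, h j hj]
    simp [this]
  · intro v
    have h1 : ∀ j, j ≠ t → Function.update b t v j = b j := fun j hj => by simp [hj]
    have h2 : (∀ j, j ≠ t → a j = Function.update b t v j) ↔ ∀ j, j ≠ t → a j = b j :=
      forall₂_congr fun j hj => by simp [hj]
    simp only [h2, hA, Function.update_self]
    split_ifs <;> simp

theorem muxMatrix_one (t : ι) : muxMatrix t (fun _ => 1) = 1 := by
  ext a b
  simp only [muxMatrix, Matrix.of_apply, Matrix.one_apply]
  by_cases h : a = b
  · simp [h]
  · have : ¬ ((∀ j, j ≠ t → a j = b j) ∧ a t = b t) := by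
      rintro ⟨h1, h2⟩
      refine h (funext fun j => ?_)
      by_cases hj : j = t
      · rw [hj, h2]
      · exact h1 j hj
    rw [if_neg h]
    split_ifs with h1 h2
    · exact absurd ⟨h1, h2⟩ this
    · rfl
    · rfl

theorem pauliXPow_mul (s r : Bool) : pauliXPow s * pauliXPow r = pauliXPow (xor s r) := by
  ext i j
  cases s <;> cases r <;> cases i <;> cases j <;> simp [pauliXPow, Matrix.mul_apply]

theorem pauliXPow_false : pauliXPow false = 1 := by
  ext i j
  cases i <;> cases j <;> simp [pauliXPow]

theorem QGate.matrix_single (t : ι) (U : Matrix.unitaryGroup Bool ℂ) :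
    (QGate.single t U).matrix = muxMatrix t fun _ => (U : Matrix Bool Bool ℂ) := rfl

theorem QGate.matrix_cnot (c t : ι) (h : c ≠ t) :
    (QGate.cnot c t h).matrix = muxMatrix t fun b => pauliXPow (b c) := by
  ext a b
  simp only [QGate.matrix, muxMatrix, pauliXPow, Matrix.of_apply]
  by_cases h1 : ∀ j, j ≠ t → a j = b j
  · rw [if_pos h1]
    congr 1
    refine propext ⟨fun h2 => by rw [h2]; simp, fun h2 => ?_⟩
    ext j
    by_cases hj : j = t
    · subst hj; simpa using h2
    · simp [hj, h1 j hj]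
  · rw [if_neg h1, if_neg]
    rintro rfl
    exact h1 fun j hj => by simp [hj]

/-! ### Concatenation, inversion and relabelling of circuits -/

theorem QCircuit.matrix_append (C D : QCircuit ι) :
    QCircuit.matrix (C ++ D) = D.matrix * C.matrix := by
  induction C with
  | nil => simp [QCircuit.matrix]
  | cons g l ih => simp [QCircuit.matrix, ih, Matrix.mul_assoc]

theorem QCircuit.cnotCount_append {ι : Type} (C D : QCircuit ι) :
    QCircuit.cnotCount (C ++ D) = C.cnotCount + D.cnotCount := by
  induction C with
  | nil => simp [QCircuit.cnotCount]
  | cons g l ih =>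
    rcases g with _ | _
    · simpa [QCircuit.cnotCount] using ih
    · simp only [List.cons_append, QCircuit.cnotCount, ih]
      omega

/-- The inverse of an elementary gate. -/
def QGate.inv {ι : Type} : QGate ι → QGate ι
  | .single i U => .single i U⁻¹
  | .cnot c t h => .cnot c t h

/-- The inverse of a circuit. -/
def QCircuit.inv {ι : Type} (C : QCircuit ι) : QCircuit ι := (C.map QGate.inv).reverse

theorem QGate.matrix_mul_inv (g : QGate ι) : g.matrix * g.inv.matrix = 1 := by
  rcases g with ⟨t, U⟩ | ⟨c, t, h⟩
  · rw [QGate.inv, QGate.matrix_single, QGate.matrix_single, muxMatrix_mul _ _ _ fun _ _ => rfl,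
      ← muxMatrix_one t]
    congr 1
    ext1 b
    exact congrArg Subtype.val (mul_inv_cancel U)
  · rw [QGate.inv, QGate.matrix_cnot, muxMatrix_mul, ← muxMatrix_one t]
    · simp [pauliXPow_mul, pauliXPow_false]
    · simp [h]

theorem QCircuit.inv_cons {ι : Type} (g : QGate ι) (C : QCircuit ι) :
    QCircuit.inv (g :: C) = C.inv ++ [g.inv] := by
  simp [QCircuit.inv]

theorem QCircuit.matrix_mul_inv (C : QCircuit ι) : C.matrix * C.inv.matrix = 1 := by
  induction C with
  | nil => simp [QCircuit.inv, QCircuit.matrix]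
  | cons g l ih =>
    rw [QCircuit.inv_cons, QCircuit.matrix_append]
    simp only [QCircuit.matrix, one_mul]
    rw [Matrix.mul_assoc, ← Matrix.mul_assoc g.matrix, QGate.matrix_mul_inv, one_mul, ih]

theorem QCircuit.cnotCount_inv {ι : Type} (C : QCircuit ι) : C.inv.cnotCount = C.cnotCount := by
  induction C with
  | nil => rfl
  | cons g l ih =>
    rw [QCircuit.inv_cons, QCircuit.cnotCount_append, ih]
    rcases g with _ | _ <;> simp [QCircuit.cnotCount, QGate.inv]

/-- The gate with its wires relabelled. -/
def QGate.relabel (j : ι ↪ κ) : QGate ι → QGate κ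
  | .single i U => .single (j i) U
  | .cnot c t h => .cnot (j c) (j t) (j.injective.ne h)

/-- The circuit with its wires relabelled, as a circuit on a larger register. -/
def QCircuit.relabel (j : ι ↪ κ) (C : QCircuit ι) : QCircuit κ := C.map (QGate.relabel j)

theorem QCircuit.cnotCount_relabel {ι κ : Type} (j : ι ↪ κ) (C : QCircuit ι) :
    (C.relabel j).cnotCount = C.cnotCount := by
  induction C with
  | nil => rfl
  | cons g l ih =>
    rcases g with _ | _
    · exact ih
    · exact congrArg (· + 1) ih

theorem QGate.matrix_relabel (j : ι ↪ κ) (g : QGate ι) (a b : κ → Bool) :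
    (g.relabel j).matrix a b =
      if ∀ k, k ∉ Set.range j → a k = b k then g.matrix (a ∘ j) (b ∘ j) else 0 := by
  have key : ∀ t : ι, (∀ k, k ≠ j t → a k = b k) ↔
      (∀ k, k ∉ Set.range j → a k = b k) ∧ ∀ i, i ≠ t → (a ∘ j) i = (b ∘ j) i := by
    intro t
    constructor
    · exact fun h => ⟨fun k hk => h k fun e => hk ⟨t, e.symm⟩,
        fun i hi => h _ (j.injective.ne hi)⟩
    · rintro ⟨h1, h2⟩ k hk
      by_cases hr : k ∈ Set.range j
      · obtain ⟨i, rfl⟩ := hr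
        exact h2 i fun e => hk (by rw [e])
      · exact h1 k hr
  rcases g with ⟨t, U⟩ | ⟨c, t, h⟩
  · rw [QGate.relabel, QGate.matrix_single, QGate.matrix_single]
    simp only [muxMatrix, Matrix.of_apply, key, ite_and, Function.comp_apply]
  · rw [QGate.relabel, QGate.matrix_cnot, QGate.matrix_cnot]
    simp only [muxMatrix, Matrix.of_apply, key, ite_and, Function.comp_apply]

theorem QCircuit.matrix_relabel (j : ι ↪ κ) (C : QCircuit ι) (a b : κ → Bool) :
    (C.relabel j).matrix a b =
      if ∀ k, k ∉ Set.range j → a k = b k then C.matrix (a ∘ j) (b ∘ j) else 0 := by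
  induction C generalizing a b with
  | nil =>
    simp only [QCircuit.relabel, List.map_nil, QCircuit.matrix, Matrix.one_apply]
    rw [← ite_and]
    congr 1
    refine propext ⟨by rintro rfl; simp, fun ⟨h1, h2⟩ => funext fun k => ?_⟩
    by_cases hr : k ∈ Set.range j
    · obtain ⟨i, rfl⟩ := hr
      exact congrFun h2 i
    · exact h1 k hr
  | cons g l ih =>
    have hc : QCircuit.relabel j (g :: l) = g.relabel j :: QCircuit.relabel j l := rfl
    simp only [hc, QCircuit.matrix, Matrix.mul_apply, ih, QGate.matrix_relabel]
    have hinj : Function.Injective fun c : ι → Bool => Function.extend j c b := by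
      intro c c' h
      ext i
      have := congrFun h (j i)
      simpa [j.injective.extend_apply] using this
    rw [← Fintype.sum_of_injective (fun c : ι → Bool => Function.extend j c b) hinj
      (fun c => if ∀ k, k ∉ Set.range j → a k = b k then
        QCircuit.matrix l (a ∘ j) c * g.matrix c (b ∘ j) else 0)]
    · split_ifs <;> simp
    · intro c hc
      have : ¬ ∀ k, k ∉ Set.range j → c k = b k := by
        intro h
        refine hc ⟨c ∘ j, funext fun k => ?_⟩
        by_cases hr : k ∈ Set.range j
        · obtain ⟨i, rfl⟩ := hr
          simp [j.injective.extend_apply]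
        · rw [h k hr]
          exact Function.extend_apply' _ _ _ hr
      rw [if_neg this, mul_zero]
    · intro c
      have h1 : ∀ k, k ∉ Set.range j → Function.extend j c b k = b k :=
        fun k hk => Function.extend_apply' _ _ _ hk
      have h2 : (∀ k, k ∉ Set.range j → a k = Function.extend j c b k) ↔
          ∀ k, k ∉ Set.range j → a k = b k :=
        forall₂_congr fun k hk => by rw [h1 k hk]
      have h3 : Function.extend j c b ∘ j = c := by
        ext i
        simp [j.injective.extend_apply]
      simp only [h2, h3, if_pos h1]
      split_ifs <;> simp

/-! ### Circuits which map a basis state to a multiple of a basis state -/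

/-- The circuit `C` maps the basis state `b` to `z` times the basis state `b'`. -/
def QCircuit.Sends (C : QCircuit ι) (b : ι → Bool) (z : ℂ) (b' : ι → Bool) : Prop :=
  ∀ a, C.matrix a b = if a = b' then z else 0

theorem QCircuit.Sends.append {C D : QCircuit ι} {b b' b'' : ι → Bool} {z w : ℂ}
    (hC : C.Sends b z b') (hD : D.Sends b' w b'') :
    QCircuit.Sends (C ++ D) b (w * z) b'' := by
  intro a
  simp [QCircuit.matrix_append, Matrix.mul_apply, hC _, hD _]

theorem QCircuit.Sends.inv {C : QCircuit ι} {b b' : ι → Bool} {z : ℂ} (hz : z ≠ 0)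
    (hC : C.Sends b z b') : C.inv.Sends b' z⁻¹ b := by
  intro a
  have h : C.inv.matrix * C.matrix = 1 := mul_eq_one_comm.1 C.matrix_mul_inv
  have h1 := congrFun (congrFun h a) b
  simp only [Matrix.mul_apply, hC _, mul_ite, mul_zero, Finset.sum_ite_eq', Finset.mem_univ,
    if_true, Matrix.one_apply] at h1
  rw [eq_div_of_mul_eq hz h1]
  split_ifs <;> simp

theorem QCircuit.Sends.relabel (j : ι ↪ κ) {C : QCircuit ι} {b b' : κ → Bool} {z : ℂ}
    (hC : C.Sends (b ∘ j) z (b' ∘ j)) (hb : ∀ k, k ∉ Set.range j → b' k = b k) :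
    (C.relabel j).Sends b z b' := by
  intro a
  rw [QCircuit.matrix_relabel, hC, ← ite_and]
  congr 1
  refine propext ⟨fun ⟨h1, h2⟩ => funext fun k => ?_, ?_⟩
  · by_cases hr : k ∈ Set.range j
    · obtain ⟨i, rfl⟩ := hr
      exact congrFun h2 i
    · rw [h1 k hr, hb k hr]
  · rintro rfl
    exact ⟨hb, rfl⟩

/-- The map `f` of basis states can be realised, up to phases, with at most `k` CNOTs. -/
def Reachable (k : ℕ) (f : (ι → Bool) → ι → Bool) : Prop :=
  ∃ C : QCircuit ι, C.cnotCount ≤ k ∧ ∀ b, ∃ z : ℂ, ‖z‖ = 1 ∧ C.Sends b z (f b)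

theorem Reachable.comp {k l : ℕ} {f g : (ι → Bool) → ι → Bool} (hf : Reachable k f)
    (hg : Reachable l g) : Reachable (k + l) (g ∘ f) := by
  obtain ⟨C, hC, hC'⟩ := hf
  obtain ⟨D, hD, hD'⟩ := hg
  refine ⟨C ++ D, by rw [QCircuit.cnotCount_append]; omega, fun b => ?_⟩
  obtain ⟨z, hz, h1⟩ := hC' b
  obtain ⟨w, hw, h2⟩ := hD' (f b)
  exact ⟨w * z, by simp [hz, hw], h1.append h2⟩

theorem Reachable.mono {k l : ℕ} {f : (ι → Bool) → ι → Bool} (hf : Reachable k f) (h : k ≤ l) :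
    Reachable l f := by
  obtain ⟨C, hC, hC'⟩ := hf
  exact ⟨C, hC.trans h, hC'⟩

theorem Reachable.id : Reachable 0 (id : (ι → Bool) → ι → Bool) :=
  ⟨[], le_rfl, fun b => ⟨1, by simp, fun a => by simp [QCircuit.matrix, Matrix.one_apply]⟩⟩

theorem Reachable.inv {k : ℕ} {f g : (ι → Bool) → ι → Bool} (hf : Reachable k f)
    (h : ∀ b, f (g b) = b) : Reachable k g := by
  obtain ⟨C, hC, hC'⟩ := hf
  refine ⟨C.inv, by rwa [QCircuit.cnotCount_inv], fun b => ?_⟩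
  obtain ⟨z, hz, h1⟩ := hC' (g b)
  rw [h] at h1
  exact ⟨z⁻¹, by simp [hz], h1.inv fun h0 => by simp [h0] at hz⟩

/-- Injectivity comes from the inverse circuit, which sends a common image back to a single basis
state up to a nonzero scalar; finiteness gives the rest. -/
theorem Reachable.bijective {k : ℕ} {f : (ι → Bool) → ι → Bool} (hf : Reachable k f) :
    Function.Bijective f := by
  obtain ⟨C, -, hC⟩ := hf
  refine Finite.injective_iff_bijective.1 fun b b' h => ?_
  obtain ⟨z, hz, h1⟩ := hC b
  obtain ⟨w, hw, h2⟩ := hC b'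
  have hz0 : z ≠ 0 := fun h0 => by simp [h0] at hz
  have hw0 : w ≠ 0 := fun h0 => by simp [h0] at hw
  rw [← h] at h2
  have e1 := (h1.inv hz0) b
  have e2 := (h2.inv hw0) b
  rw [e1, if_pos rfl] at e2
  by_contra hne
  rw [if_neg hne] at e2
  exact inv_ne_zero hz0 e2

theorem Reachable.relabel (j : ι ↪ κ) {k : ℕ} {f : (ι → Bool) → ι → Bool} (hf : Reachable k f) :
    Reachable k fun b : κ → Bool => Function.extend j (f (b ∘ j)) b := by
  obtain ⟨C, hC, hC'⟩ := hf
  refine ⟨C.relabel j, by rwa [QCircuit.cnotCount_relabel], fun b => ?_⟩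
  obtain ⟨z, hz, h1⟩ := hC' (b ∘ j)
  refine ⟨z, hz, QCircuit.Sends.relabel j ?_ fun k hk => Function.extend_apply' _ _ _ hk⟩
  rwa [Function.extend_comp j.injective]

end Circuits

/-! ### Uniformly controlled rotations -/

section Multiplexors

variable {ι : Type} [Fintype ι] [DecidableEq ι]

/-- A one-parameter group of single-qubit gates whose members are inverted by conjugation with
the Pauli matrix `X`. -/
structure IsRotation (R : ℝ → Matrix.unitaryGroup Bool ℂ) : Prop where
  add : ∀ a b, R (a + b) = R a * R b
  conj : ∀ a, (R a : Matrix Bool Bool ℂ) * pauliXPow true = pauliXPow true * R (-a)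

theorem IsRotation.mul_pauliXPow {R : ℝ → Matrix.unitaryGroup Bool ℂ} (hR : IsRotation R)
    (a : ℝ) (s : Bool) :
    (R a : Matrix Bool Bool ℂ) * pauliXPow s = pauliXPow s * R (if s then -a else a) := by
  cases s
  · simp [pauliXPow_false]
  · simpa using hR.conj a

/-- The value of the first wire of a list, `false` for the empty list. -/
def headBit {ι : Type} : List ι → (ι → Bool) → Bool
  | [], _ => false
  | c :: _, b => b c

/-- The function `f` of basis states depends only on the wires in the list `l`. -/
def DependsOnly {ι : Type} {α : Type*} (l : List ι) (f : (ι → Bool) → α) : Prop :=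
  ∀ b b', (∀ j ∈ l, b j = b' j) → f b = f b'

theorem DependsOnly.update {ι : Type} [DecidableEq ι] {α : Type*} {l : List ι} {f : (ι → Bool) → α} (hf : DependsOnly l f)
    {t : ι} (ht : t ∉ l) (b : ι → Bool) (v : Bool) : f (Function.update b t v) = f b :=
  hf _ _ fun j hj => by simp [ne_of_mem_of_not_mem hj ht]

theorem DependsOnly.fix {ι : Type} [DecidableEq ι] {α : Type*} {c : ι} {l : List ι} {f : (ι → Bool) → α}
    (hf : DependsOnly (c :: l) f) (v : Bool) :
    DependsOnly l fun b => f (Function.update b c v) := by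
  refine fun b b' h => hf _ _ fun j hj => ?_
  by_cases hjc : j = c
  · simp [hjc]
  · simp [hjc, h j ((List.mem_cons.1 hj).resolve_left hjc)]

theorem dependsOnly_headBit {ι : Type} (l : List ι) : DependsOnly l (headBit l) := by
  intro b b' h
  cases l with
  | nil => rfl
  | cons c l => exact h c (by simp)

/-- Splitting the angle into half-sum and half-difference over the control `c` gives two smaller
multiplexors around one CNOT. Allowing a leftover `X` controlled by the first wire saves the closing
CNOT at every level, so the count satisfies `N + 1 = 2 ^ k`. -/
theorem exists_circuit_rotation {R : ℝ → Matrix.unitaryGroup Bool ℂ} (hR : IsRotation R) (t : ι)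
    (l : List ι) (ht : t ∉ l) (θ : (ι → Bool) → ℝ) (hθ : DependsOnly l θ) :
    ∃ C : QCircuit ι, C.cnotCount + 1 = 2 ^ l.length ∧
      C.matrix = muxMatrix t fun b => pauliXPow (headBit l b) * R (θ b) := by
  induction l generalizing θ with
  | nil =>
    refine ⟨[.single t (R (θ fun _ => false))], by simp [QCircuit.cnotCount], ?_⟩
    simp only [QCircuit.matrix, one_mul, QGate.matrix_single, headBit, pauliXPow_false]
    congr 1
    ext1 b
    rw [hθ b (fun _ => false) (by simp)]
  | cons c l ih =>
    have htc : c ≠ t := fun h => ht (by simp [h])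
    have htl : t ∉ l := fun h => ht (by simp [h])
    set θ₀ : (ι → Bool) → ℝ := fun b => θ (Function.update b c false) with hθ₀
    set θ₁ : (ι → Bool) → ℝ := fun b => θ (Function.update b c true) with hθ₁
    have h₀ : DependsOnly l θ₀ := hθ.fix false
    have h₁ : DependsOnly l θ₁ := hθ.fix true
    have hh := dependsOnly_headBit l
    set α : (ι → Bool) → ℝ := fun b => (θ₀ b + θ₁ b) / 2 with hα
    -- The sign anticipates that the leftover `X` of the first block reverses the rotation of the
    -- second.
    set β : (ι → Bool) → ℝ := fun b =>
      if headBit l b then -((θ₀ b - θ₁ b) / 2) else (θ₀ b - θ₁ b) / 2 with hβ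
    have hdα : DependsOnly l α := fun b b' h => by simp only [hα, h₀ b b' h, h₁ b b' h]
    have hdβ : DependsOnly l β := fun b b' h => by
      simp only [hβ, h₀ b b' h, h₁ b b' h, hh b b' h]
    obtain ⟨C, hC, hC'⟩ := ih htl α hdα
    obtain ⟨D, hD, hD'⟩ := ih htl β hdβ
    refine ⟨C ++ .cnot c t htc :: D, ?_, ?_⟩
    · simp only [QCircuit.cnotCount_append, QCircuit.cnotCount, List.length_cons, pow_succ]
      omega
    · rw [QCircuit.matrix_append]
      simp only [QCircuit.matrix, hC', hD', QGate.matrix_cnot]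
      have u1 : ∀ b v, (pauliXPow (headBit l (Function.update b t v)) *
          (R (β (Function.update b t v)) : Matrix Bool Bool ℂ)) =
          pauliXPow (headBit l b) * R (β b) := fun b v => by
        rw [hh.update htl, hdβ.update htl]
      rw [muxMatrix_mul _ _ _ u1, muxMatrix_mul]
      · congr 1
        ext1 b
        -- The two leftovers of the inner multiplexors cancel once moved past the rotations, leaving
        -- only the new one, controlled by `c`.
        have e : ((pauliXPow (headBit l b) * (R (β b) : Matrix Bool Bool ℂ)) *
            pauliXPow (b c)) * (pauliXPow (headBit l b) * (R (α b) : Matrix Bool Bool ℂ)) =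
            pauliXPow (b c) * (R ((if xor (b c) (headBit l b) then -β b else β b) + α b) :
              Matrix Bool Bool ℂ) := by
          rw [Matrix.mul_assoc (pauliXPow (headBit l b)), Matrix.mul_assoc,
            Matrix.mul_assoc (R (β b) : Matrix Bool Bool ℂ),
            ← Matrix.mul_assoc (pauliXPow (b c)), pauliXPow_mul,
            ← Matrix.mul_assoc (R (β b) : Matrix Bool Bool ℂ), hR.mul_pauliXPow, hR.add,
            Matrix.mul_assoc, ← Matrix.mul_assoc (pauliXPow _), pauliXPow_mul,
            Submonoid.coe_mul]
          congr 2
          cases b c <;> cases headBit l b <;> rfl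
        rw [e]
        have hb : (if xor (b c) (headBit l b) then -β b else β b) + α b = θ b := by
          have hs : Function.update b c (b c) = b := by simp
          have : θ b = if b c then θ₁ b else θ₀ b := by
            cases hbc : b c <;> rw [hbc] at hs <;> simp [hθ₀, hθ₁, hs]
          rw [this]
          simp only [hβ, hα]
          cases b c <;> cases headBit l b <;> simp <;> ring
        rw [hb]
        rfl
      · intro b v
        rw [u1]
        simp [htc]

/-- The rotation about the `y`-axis. -/
noncomputable def rotY (θ : ℝ) : Matrix.unitaryGroup Bool ℂ :=
  ⟨Matrix.of fun i j => if i = j then (Real.cos θ : ℂ) else if i then (Real.sin θ : ℂ)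
      else -(Real.sin θ : ℂ), by
    have h : (Real.cos θ : ℂ) * Real.cos θ + (Real.sin θ : ℂ) * Real.sin θ = 1 := by
      norm_cast
      nlinarith [Real.sin_sq_add_cos_sq θ]
    rw [Matrix.mem_unitaryGroup_iff]
    ext i j
    have h' := h
    rw [add_comm] at h'
    cases i <;> cases j <;>
      simp [Matrix.mul_apply, -Complex.ofReal_cos, -Complex.ofReal_sin,
        Matrix.star_eq_conjTranspose, Complex.conj_ofReal, h, h', mul_comm]⟩

theorem isRotation_rotY : IsRotation rotY where
  add a b := by
    ext i j
    simp only [rotY, Submonoid.coe_mul, Matrix.mul_apply, Matrix.of_apply, Fintype.sum_bool,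
      Real.cos_add, Real.sin_add]
    cases i <;> cases j <;> simp <;> ring
  conj a := by
    ext i j
    cases i <;> cases j <;> simp [rotY, pauliXPow, Matrix.mul_apply]

/-- The diagonal single-qubit gate with phases `exp (i θ)`. -/
noncomputable def phaseGate (θ : Bool → ℝ) : Matrix.unitaryGroup Bool ℂ :=
  ⟨Matrix.diagonal fun i => ((Circle.exp (θ i) : Circle) : ℂ), by
    rw [Matrix.mem_unitaryGroup_iff, Matrix.star_eq_conjTranspose, Matrix.diagonal_conjTranspose,
      Matrix.diagonal_mul_diagonal, ← Matrix.diagonal_one]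
    congr 1
    ext1 i
    rw [Pi.star_apply, Complex.star_def, Complex.mul_conj, Complex.normSq_eq_norm_sq,
      Circle.norm_coe]
    simp⟩

theorem phaseGate_mul (θ ψ : Bool → ℝ) : phaseGate θ * phaseGate ψ = phaseGate (θ + ψ) := by
  apply Subtype.ext
  simp only [phaseGate, Submonoid.coe_mul, Matrix.diagonal_mul_diagonal, Pi.add_apply,
    Circle.exp_add, Circle.coe_mul]

theorem muxMatrix_phaseGate (t : ι) (θ : (ι → Bool) → Bool → ℝ) :
    muxMatrix t (fun b => (phaseGate (θ b) : Matrix Bool Bool ℂ)) =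
      Matrix.diagonal fun b => ((Circle.exp (θ b (b t)) : Circle) : ℂ) := by
  ext a b
  simp only [muxMatrix, phaseGate, Matrix.of_apply, Matrix.diagonal_apply]
  rw [← ite_and]
  by_cases hab : a = b
  · subst hab; simp
  · rw [if_neg hab, if_neg]
    rintro ⟨h1, h2⟩
    refine hab (funext fun j => ?_)
    by_cases hj : j = t
    · rw [hj, h2]
    · exact h1 j hj

/-- The rotation about the `z`-axis. -/
noncomputable def rotZ (θ : ℝ) : Matrix.unitaryGroup Bool ℂ :=
  phaseGate fun i => if i then -θ else θ

theorem isRotation_rotZ : IsRotation rotZ where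
  add a b := by
    rw [rotZ, rotZ, rotZ, phaseGate_mul]
    congr 1
    ext1 i
    cases i <;> simp [add_comm]
  conj a := by
    ext i j
    cases i <;> cases j <;> simp [rotZ, phaseGate, pauliXPow, Matrix.mul_apply, Matrix.diagonal_apply]

/-- The map which flips the wire `t` if `φ` holds. -/
def toggle {ι : Type} [DecidableEq ι] (t : ι) (φ : (ι → Bool) → Bool) (b : ι → Bool) : ι → Bool :=
  Function.update b t (xor (b t) (φ b))

theorem toggle_self {ι : Type} [DecidableEq ι] (t : ι) (φ : (ι → Bool) → Bool) (b : ι → Bool) :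
    toggle t φ b t = xor (b t) (φ b) := by simp [toggle]

theorem toggle_ne {ι : Type} [DecidableEq ι] {t j : ι} (h : j ≠ t) (φ : (ι → Bool) → Bool) (b : ι → Bool) :
    toggle t φ b j = b j := by simp [toggle, h]

theorem reachable_toggle_list (t : ι) (l : List ι) (ht : t ∉ l) (φ : (ι → Bool) → Bool)
    (hφ : DependsOnly l φ) : Reachable (2 ^ l.length - 1) (toggle t φ) := by
  -- `rotY (π / 2)` is `X` up to signs, and the term `headBit l b` in the condition cancels the
  -- leftover `X` of the multiplexor.
  set θ : (ι → Bool) → ℝ := fun b => if xor (φ b) (headBit l b) then Real.pi / 2 else 0 with hθ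
  have hd : DependsOnly l θ := fun b b' h => by
    simp only [hθ, hφ b b' h, dependsOnly_headBit l b b' h]
  obtain ⟨C, hC, hC'⟩ := exists_circuit_rotation isRotation_rotY t l ht θ hd
  refine ⟨C, by omega, fun b => ?_⟩
  have key : ∃ z : ℂ, ‖z‖ = 1 ∧ ∀ i, (pauliXPow (headBit l b) *
      (rotY (θ b) : Matrix Bool Bool ℂ)) i (b t) = if i = xor (b t) (φ b) then z else 0 := by
    simp only [hθ]
    cases φ b <;> cases headBit l b <;> cases b t <;>
      simp [rotY, pauliXPow, Matrix.mul_apply]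
  obtain ⟨z, hz, h⟩ := key
  refine ⟨z, hz, fun a => ?_⟩
  rw [hC']
  simp only [muxMatrix, Matrix.of_apply, h, ← ite_and]
  congr 1
  refine propext ⟨fun ⟨h1, h2⟩ => funext fun j => ?_, ?_⟩
  · by_cases hj : j = t
    · rw [hj, toggle_self, h2]
    · rw [toggle_ne hj, h1 j hj]
  · rintro rfl
    exact ⟨fun j hj => toggle_ne hj _ _, toggle_self _ _ _⟩

/-- A flip of one wire, controlled in an arbitrary way by `k` other wires, needs at most
`2 ^ k - 1` CNOTs up to phases. -/
theorem reachable_toggle (t : ι) (K : Finset ι) (ht : t ∉ K) (φ : (ι → Bool) → Bool)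
    (hφ : ∀ b b', (∀ j ∈ K, b j = b' j) → φ b = φ b') :
    Reachable (2 ^ K.card - 1) (toggle t φ) := by
  have := reachable_toggle_list t K.toList (by simpa using ht) φ
    fun b b' h => hφ b b' fun j hj => h j (by simpa using hj)
  rwa [Finset.length_toList] at this

/-! ### Diagonal gates -/

/-- For each value of the remaining wires, the phases on `t` split into a `z`-rotation by half the
difference and the average, which no longer involves `t`. One CNOT removes the leftover `X`, so the
count is `(2 ^ (k - 1) - 1) + 1 + (2 ^ (k - 1) - 2)`. -/
theorem exists_circuit_diagonal (l : List ι) (hl : l.Nodup) (hne : l ≠ []) (θ : (ι → Bool) → ℝ)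
    (hθ : DependsOnly l θ) :
    ∃ C : QCircuit ι, C.cnotCount ≤ 2 ^ l.length - 2 ∧
      C.matrix = Matrix.diagonal fun b => ((Circle.exp (θ b) : Circle) : ℂ) := by
  induction l generalizing θ with
  | nil => exact absurd rfl hne
  | cons t l ih =>
    obtain ⟨htl, hl'⟩ := List.nodup_cons.1 hl
    set θ₀ : (ι → Bool) → ℝ := fun b => θ (Function.update b t false) with hθ₀
    set θ₁ : (ι → Bool) → ℝ := fun b => θ (Function.update b t true) with hθ₁
    have h₀ : DependsOnly l θ₀ := hθ.fix false
    have h₁ : DependsOnly l θ₁ := hθ.fix true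
    have hdiff : DependsOnly l fun b => (θ₀ b - θ₁ b) / 2 := fun b b' h => by
      simp only [h₀ b b' h, h₁ b b' h]
    have havg : DependsOnly l fun b => (θ₀ b + θ₁ b) / 2 := fun b b' h => by
      simp only [h₀ b b' h, h₁ b b' h]
    obtain ⟨C, hC, hC'⟩ := exists_circuit_rotation isRotation_rotZ t l htl _ hdiff
    have hb : ∀ b, θ b = (θ₀ b + θ₁ b) / 2 +
        (if b t then -((θ₀ b - θ₁ b) / 2) else (θ₀ b - θ₁ b) / 2) := by
      intro b
      have hs : Function.update b t (b t) = b := by simp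
      cases hbt : b t <;> rw [hbt] at hs <;> simp [hθ₀, hθ₁, hs] <;> ring
    cases l with
    | nil =>
      refine ⟨[.single t (phaseGate fun v => θ fun _ => v)], by simp [QCircuit.cnotCount], ?_⟩
      simp only [QCircuit.matrix, one_mul, QGate.matrix_single]
      rw [muxMatrix_phaseGate t fun _ v => θ fun _ => v]
      congr 1
      ext1 b
      rw [hθ (fun _ => b t) b (by simp)]
    | cons c l =>
      have htc : c ≠ t := fun h => htl (by simp [h])
      obtain ⟨D, hD, hD'⟩ := ih hl' (by simp) _ havg
      refine ⟨C ++ .cnot c t htc :: D, ?_, ?_⟩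
      · simp only [QCircuit.cnotCount_append, QCircuit.cnotCount, List.length_cons, pow_succ] at *
        have : 0 < 2 ^ l.length := by positivity
        omega
      · rw [QCircuit.matrix_append]
        simp only [QCircuit.matrix, hC', hD', QGate.matrix_cnot, headBit]
        rw [Matrix.mul_assoc, muxMatrix_mul]
        · simp only [← Matrix.mul_assoc, pauliXPow_mul, Bool.xor_self, pauliXPow_false, one_mul]
          simp only [rotZ]
          rw [muxMatrix_phaseGate, Matrix.diagonal_mul_diagonal]
          congr 1
          ext1 b
          rw [hb b, Circle.exp_add, Circle.coe_mul]
        · simp [htc]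

end Multiplexors

/-! ### Permutations as products of controlled flips -/

/-- Two fixed-point-free involutions have a common proper 2-colouring. -/
theorem exists_coloring_of_involutions {α : Type*} (p q : Equiv.Perm α) (hp : p * p = 1)
    (hq : q * q = 1) (hp' : ∀ x, p x ≠ x) (hq' : ∀ x, q x ≠ x) :
    ∃ f : α → Bool, (∀ x, f (p x) = !f x) ∧ ∀ x, f (q x) = !f x := by
  classical
  set r := p * q with hr
  have hpi : p⁻¹ = p := inv_eq_of_mul_eq_one_left hp
  have hqi : q⁻¹ = q := inv_eq_of_mul_eq_one_left hq
  have hconj : p * r * p⁻¹ = r⁻¹ := by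
    rw [hr, mul_inv_rev, hpi, hqi, ← mul_assoc, hp, one_mul]
  have hconjk : ∀ k : ℤ, p * r ^ k * p⁻¹ = r ^ (-k) := fun k => by
    rw [← conj_zpow, hconj, inv_zpow']
  have hpr : p * r = q := by rw [hr, ← mul_assoc, hp, one_mul]
  -- Every `p * r ^ k` is a reflection of the dihedral group generated by `p` and `q`, hence
  -- conjugate to `p` for even `k` and to `q` for odd `k`, so it has no fixed point.
  have hne : ∀ x (k : ℤ), (r ^ k) x ≠ p x := by
    intro x k h
    obtain ⟨j, hj⟩ := Int.even_or_odd' k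
    have h1 : (p * r ^ k) x = x := by
      rw [Equiv.Perm.mul_apply, h, ← Equiv.Perm.mul_apply, hp, Equiv.Perm.one_apply]
    have h2 : p * r ^ (2 * j) = r ^ (-j) * p * r ^ j := by
      rw [← hconjk, two_mul, zpow_add]
      group
    rcases hj with hj | hj
    · rw [hj, h2] at h1
      refine hp' ((r ^ j) x) ?_
      have := congrArg (r ^ j) h1
      rwa [← Equiv.Perm.mul_apply, ← mul_assoc, ← mul_assoc, ← zpow_add, add_neg_cancel,
        zpow_zero, one_mul, Equiv.Perm.mul_apply] at this
    · have h3 : p * r ^ (2 * j + 1) = r ^ (-j) * q * r ^ j := by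
        rw [zpow_add_one, ← mul_assoc, h2, mul_assoc _ (r ^ j) r,
          ((Commute.refl r).zpow_left j).eq, ← mul_assoc, mul_assoc _ p r, hpr]
      rw [hj, h3] at h1
      refine hq' ((r ^ j) x) ?_
      have := congrArg (r ^ j) h1
      rwa [← Equiv.Perm.mul_apply, ← mul_assoc, ← mul_assoc, ← zpow_add, add_neg_cancel,
        zpow_zero, one_mul, Equiv.Perm.mul_apply] at this
  let s := Equiv.Perm.SameCycle.setoid r
  let o : α → Quotient s := Quotient.mk s
  have ho : ∀ x y, o x = o y ↔ r.SameCycle x y := fun x y => Quotient.eq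
  have hop : ∀ x y, o x = o y → o (p x) = o (p y) := by
    intro x y h
    rw [ho] at h ⊢
    obtain ⟨k, hk⟩ := h
    refine ⟨-k, ?_⟩
    rw [← hk, ← hconjk]
    simp
  have hoq : ∀ x, o (q x) = o (p x) := by
    intro x
    rw [← hpr]
    refine hop _ _ ?_
    rw [ho]
    exact (Equiv.Perm.SameCycle.refl r x).apply_left
  have hor : ∀ x, o (p x) ≠ o x := by
    intro x h
    rw [ho] at h
    obtain ⟨k, hk⟩ := h.symm
    exact hne x k hk
  have hpp : ∀ x, p (p x) = x := fun x => by
    rw [← Equiv.Perm.mul_apply, hp, Equiv.Perm.one_apply]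
  -- Both `p` and `q` exchange the two distinct `r`-orbits `o x` and `o (p x)`. An arbitrary linear
  -- order on the orbits decides which of the two gets which colour.
  let L : LinearOrder (Quotient s) := linearOrderOfSTO WellOrderingRel
  have key : ∀ x y, o y = o (p x) → decide (o y < o (p y)) = !decide (o x < o (p x)) := by
    intro x y h
    have h1 : o (p y) = o x := by rw [hop _ _ h, hpp]
    rw [h1, h]
    rcases lt_or_gt_of_ne (hor x) with h2 | h2
    · simp [h2, h2.le]
    · simp [h2, h2.le]
  exact ⟨fun x => decide (o x < o (p x)), fun x => key x _ rfl, fun x => key x _ (hoq x)⟩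

section Permutations

variable {ι : Type} [Fintype ι] [DecidableEq ι]

/-- A permutation of basis states which only changes the wires in `T`. -/
theorem reachable_perm_of_fixes (i : ι) (T : Finset ι) (hi : i ∉ T)
    (σ : Equiv.Perm (ι → Bool)) (hσ : ∀ b, ∀ j, j ∉ insert i T → σ b j = b j) :
    Reachable ((2 * T.card + 1) * (2 ^ (Fintype.card ι - 1) - 1)) σ := by
  have hcard : ∀ i : ι, (Finset.univ.erase i).card = Fintype.card ι - 1 := fun i => by
    rw [Finset.card_erase_of_mem (Finset.mem_univ i), Finset.card_univ]
  have htog : ∀ (i : ι) (φ : (ι → Bool) → Bool), (∀ b, φ (toggle i (fun _ => true) b) = φ b) →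
      Reachable (2 ^ (Fintype.card ι - 1) - 1) (toggle i φ) := by
    intro i φ hφ
    rw [← hcard i]
    refine reachable_toggle i _ (by simp) φ fun b b' h => ?_
    by_cases hb : b i = b' i
    · congr 1
      ext j
      by_cases hj : j = i
      · rw [hj, hb]
      · exact h j (by simp [hj])
    · rw [← hφ b]
      congr 1
      ext j
      by_cases hj : j = i
      · subst hj
        rw [toggle_self]
        revert hb
        cases b j <;> cases b' j <;> simp
      · rw [toggle_ne hj]
        exact h j (by simp [hj])
  induction T using Finset.induction_on generalizing i σ with
  | empty =>
    -- Only the wire `i` changes, so `σ` is a single flip; injectivity of `σ` shows that its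
    -- condition does not look at bit `i`.
    have h1 : (σ : (ι → Bool) → ι → Bool) = toggle i fun b => xor (b i) (σ b i) := by
      ext b j
      by_cases hj : j = i
      · subst hj
        rw [toggle_self]
        cases b j <;> simp
      · rw [toggle_ne hj, hσ b j (by simp [hj])]
    rw [h1]
    simp only [Finset.card_empty, mul_zero, zero_add, one_mul]
    refine htog i _ fun b => ?_
    set b' := toggle i (fun _ => true) b with hb'
    have hbi : b' i = !b i := by simp [hb', toggle_self]
    have hbj : ∀ j, j ≠ i → b' j = b j := fun j hj => by rw [hb', toggle_ne hj]
    have hne : σ b' i ≠ σ b i := by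
      intro h
      have : σ b' = σ b := by
        ext j
        by_cases hj : j = i
        · rw [hj, h]
        · rw [hσ b' j (by simp [hj]), hσ b j (by simp [hj]), hbj j hj]
      have := congrFun (σ.injective this) i
      rw [hbi] at this
      simp at this
    rw [hbi]
    revert hne
    cases b i <;> cases σ b i <;> cases σ b' i <;> simp
  | insert k T hk ih =>
    have hik : i ≠ k := fun h => hi (by simp [h])
    have hiT : i ∉ T := fun h => hi (by simp [h])
    have hflip : Function.Involutive (toggle i fun _ => true) := by
      intro b
      ext j
      by_cases hj : j = i
      · subst hj; simp [toggle_self]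
      · simp [toggle_ne hj]
    set X : Equiv.Perm (ι → Bool) := hflip.toPerm with hX
    have hXa : ∀ b, X b = toggle i (fun _ => true) b := fun b => rfl
    have hXX : X * X = 1 := Equiv.ext fun b => hflip b
    have hXne : ∀ b, X b ≠ b := fun b h => by
      have := congrFun h i
      simp [hXa, toggle_self] at this
    -- The colour `f b` is the value that bit `i` shall have in the middle. It must differ for two
    -- inputs that agree off `i`, and for two inputs whose outputs agree off `i`; these are the two
    -- involutions.
    obtain ⟨f, hf1, hf2⟩ := exists_coloring_of_involutions X (σ⁻¹ * X * σ) hXX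
      (by
        have : σ⁻¹ * X * σ * (σ⁻¹ * X * σ) = σ⁻¹ * (X * X) * σ := by group
        rw [this, hXX]; group) hXne
      (fun b h => by
        refine hXne (σ b) ?_
        have := congrArg σ h
        simpa using this)
    set A : (ι → Bool) → ι → Bool := toggle i fun b => xor (b i) (f b) with hA
    set B : (ι → Bool) → ι → Bool := toggle i fun b => xor (b i) (f (σ.symm b)) with hB
    have hAr := htog i (fun b => xor (b i) (f b)) fun b => by
      rw [← hXa, hf1, hXa, toggle_self]
      cases b i <;> simp
    have hBr := htog i (fun b => xor (b i) (f (σ.symm b))) fun b => by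
      have h := hf2 (σ.symm b)
      have h' : (σ⁻¹ * X * σ) (σ.symm b) = σ.symm (X b) := by simp
      rw [h'] at h
      rw [← hXa, h, hXa, toggle_self]
      cases b i <;> simp
    have hAi : ∀ b, A b i = f b := fun b => by
      rw [hA, toggle_self]; cases b i <;> simp
    have hAj : ∀ b j, j ≠ i → A b j = b j := fun b j hj => by rw [hA, toggle_ne hj]
    have hBi : ∀ b, B b i = f (σ.symm b) := fun b => by
      rw [hB, toggle_self]; cases b i <;> simp
    have hBj : ∀ b j, j ≠ i → B b j = b j := fun b j hj => by rw [hB, toggle_ne hj]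
    let A' : Equiv.Perm (ι → Bool) := Equiv.ofBijective A hAr.bijective
    let B' : Equiv.Perm (ι → Bool) := Equiv.ofBijective B hBr.bijective
    -- Both `A b` and `B (σ b)` carry `f b` on the wire `i`, so `τ` no longer changes that wire.
    -- Undoing `A` and `B` costs two flips per wire peeled off.
    set τ : Equiv.Perm (ι → Bool) := B' * σ * A'⁻¹ with hτ
    have hτA : ∀ b, τ (A b) = B (σ b) := fun b => by
      have : A b = A' b := rfl
      rw [this, hτ]
      change B' (σ (A'.symm (A' b))) = _
      rw [Equiv.symm_apply_apply]
      rfl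
    have hτfix : ∀ b, ∀ j, j ∉ insert k T → τ b j = b j := by
      intro b j hj
      obtain ⟨b, rfl⟩ := A'.surjective b
      change τ (A b) j = A b j
      rw [hτA]
      by_cases hji : j = i
      · rw [hji, hBi, hAi, Equiv.symm_apply_apply]
      · rw [hBj _ _ hji, hAj _ _ hji, hσ]
        simpa [hji] using hj
    have h := ih k hk τ hτfix
    have hBinv : Reachable (2 ^ (Fintype.card ι - 1) - 1) B'.symm :=
      hBr.inv fun b => B'.apply_symm_apply b
    have h2 := (hAr.comp h).comp hBinv
    have h3 : (B'.symm ∘ τ ∘ A) = (σ : (ι → Bool) → ι → Bool) := by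
      funext b
      simp only [Function.comp_apply, hτA]
      exact B'.symm_apply_apply _
    rw [← h3]
    refine h2.mono (le_of_eq ?_)
    rw [Finset.card_insert_of_notMem hk]
    ring

/-- Every permutation of the basis states of `k` qubits, up to phases. -/
theorem reachable_perm (k : ℕ) (σ : Equiv.Perm (Fin k → Bool)) :
    Reachable ((2 * k - 1) * (2 ^ (k - 1) - 1)) σ := by
  cases k with
  | zero =>
    have : (σ : (Fin 0 → Bool) → Fin 0 → Bool) = id := Subsingleton.elim _ _
    rw [this]
    exact Reachable.id.mono (Nat.zero_le _)
  | succ k =>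
    have := reachable_perm_of_fixes (0 : Fin (k + 1)) (Finset.univ.erase 0) (by simp) σ (by simp)
    refine this.mono (le_of_eq ?_)
    rw [Finset.card_erase_of_mem (Finset.mem_univ _), Finset.card_univ, Fintype.card_fin]
    congr 1

end Permutations

/-! ### Multi-controlled flips -/

section MultiControlled

variable {ι : Type} [Fintype ι] [DecidableEq ι]

/-- The basis states `b` and `p` agree on all wires of `K`. -/
def agreeOn (p : ι → Bool) (K : Finset ι) (b : ι → Bool) : Bool := decide (∀ j ∈ K, b j = p j)

theorem agreeOn_congr (p : ι → Bool) {K : Finset ι} {b b' : ι → Bool}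
    (h : ∀ j ∈ K, b j = b' j) : agreeOn p K b = agreeOn p K b' := by
  unfold agreeOn
  congr 1
  exact propext (forall₂_congr fun j hj => by rw [h j hj])

theorem agreeOn_union (p : ι → Bool) (K L : Finset ι) (b : ι → Bool) :
    agreeOn p (K ∪ L) b = (agreeOn p K b && agreeOn p L b) := by
  rw [agreeOn, agreeOn, agreeOn, ← Bool.decide_and]
  congr 1
  simp [or_imp, forall_and]

/-- The union of a list of sets of wires. -/
def unionList : List (Finset ι) → Finset ι
  | [] => ∅
  | g :: gs => g ∪ unionList gs

theorem reachable_toggle_agreeOn (t : ι) (K : Finset ι) (ht : t ∉ K) (p : ι → Bool) :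
    Reachable (2 ^ K.card - 1) (toggle t (agreeOn p K)) :=
  reachable_toggle t K ht _ fun _ _ h => agreeOn_congr p h

theorem reachable_toggle_agreeOn_and (t a : ι) (K : Finset ι) (ht : t ∉ K) (hta : t ≠ a)
    (hK : K.card ≤ 2) (p : ι → Bool) : Reachable 7 (toggle t fun b => agreeOn p K b && b a) := by
  refine (reachable_toggle t (insert a K) (by simp [ht, hta]) _ fun b b' h => ?_).mono
    (l := 7) ?_
  · rw [agreeOn_congr p fun j hj => h j (Finset.mem_insert_of_mem hj),
      h a (Finset.mem_insert_self _ _)]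
  · have : (insert a K).card ≤ 3 := (Finset.card_insert_le _ _).trans (by omega)
    have := Nat.pow_le_pow_right (n := 2) (by norm_num) this
    omega

theorem toggle_update {ι : Type} [DecidableEq ι] (t z : ι) (hz : z ≠ t) (v : Bool) (φ : (ι → Bool) → Bool) (b : ι → Bool)
    (hφ : φ (Function.update b z v) = φ b) :
    toggle t φ (Function.update b z v) = Function.update (toggle t φ b) z v := by
  unfold toggle
  rw [hφ, Function.update_of_ne hz.symm, Function.update_comm hz]

/-- A chain of flips which adds the conjunction of the conditions on the groups `g :: gs` of at
most two wires each to the wire `t`, and which may also change the wires `A`. -/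
theorem exists_chain (p : ι → Bool) (g : Finset ι) (gs : List (Finset ι)) (A : List ι) (t : ι)
    (hg : ∀ k ∈ g :: gs, k.card ≤ 2) (hA : gs.length ≤ A.length) (hnd : (t :: A).Nodup)
    (hd : ∀ a ∈ t :: A, a ∉ unionList (g :: gs)) :
    ∃ e : (ι → Bool) → ι → Bool, Reachable (14 * gs.length + 3) e ∧
      (∀ b, e b t = xor (b t) (agreeOn p (unionList (g :: gs)) b)) ∧
      (∀ b j, j ∉ t :: A → e b j = b j) ∧
      ∀ b z v, z ∉ t :: A → z ∉ unionList (g :: gs) →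
        e (Function.update b z v) = Function.update (e b) z v := by
  induction gs generalizing g A t with
  | nil =>
    have ht : t ∉ g := by simpa [unionList] using hd t (by simp)
    refine ⟨toggle t (agreeOn p g), ?_, fun b => ?_, fun b j hj => ?_, fun b z v hz hz' => ?_⟩
    · refine (reachable_toggle_agreeOn t g ht p).mono ?_
      have := Nat.pow_le_pow_right (n := 2) (by norm_num) (hg g (by simp))
      simp only [List.length_nil]
      omega
    · rw [toggle_self]
      simp [unionList]
    · exact toggle_ne (fun h => hj (by simp [h])) _ _
    · refine toggle_update t z (fun h => hz (by simp [h])) v _ b (agreeOn_congr p fun j hj => ?_)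
      have : j ≠ z := fun h => hz' (by simpa [unionList, ← h] using hj)
      simp [this]
  | cons g' gs ih =>
    obtain ⟨a, A, rfl⟩ : ∃ a A', A = a :: A' := by
      cases A with
      | nil => simp at hA
      | cons a A => exact ⟨a, A, rfl⟩
    have hU : unionList (g :: g' :: gs) = g ∪ unionList (g' :: gs) := rfl
    have hta : t ≠ a := fun h => by simp [h] at hnd
    have htA : t ∉ a :: A := (List.nodup_cons.1 hnd).1
    have hd' : ∀ x ∈ t :: a :: A, x ∉ g ∧ x ∉ unionList (g' :: gs) := fun x hx => by
      have := hd x hx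
      rw [unionList] at this
      simpa [not_or] using this
    have ht := hd' t (by simp)
    obtain ⟨e, he, he1, he2, he3⟩ := ih g' A a (fun k hk => hg k (by simp [hk]))
      (by simpa using hA) (List.nodup_cons.1 hnd).2
      (fun x hx => (hd' x (List.mem_cons_of_mem _ hx)).2)
    set φ : (ι → Bool) → Bool := fun b => agreeOn p g b && b a with hφ
    have hr := reachable_toggle_agreeOn_and t a g ht.1 hta (hg g (by simp)) p
    -- The old value of `a` enters `t` twice and cancels, so only the change that `e` makes to `a`
    -- survives, conjoined with the condition on `g`.
    refine ⟨toggle t φ ∘ e ∘ toggle t φ, ((hr.comp he).comp hr).mono ?_, fun b => ?_,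
      fun b j hj => ?_, fun b z v hz hz' => ?_⟩
    · simp only [List.length_cons]; omega
    · have q1 : agreeOn p g (e (toggle t φ b)) = agreeOn p g b := by
        refine agreeOn_congr p fun j hj => ?_
        rw [he2, toggle_ne (ne_of_mem_of_not_mem hj ht.1)]
        exact fun hm => (hd' j (List.mem_cons_of_mem _ hm)).1 hj
      have q2 : agreeOn p (unionList (g' :: gs)) (toggle t φ b) =
          agreeOn p (unionList (g' :: gs)) b :=
        agreeOn_congr p fun j hj => toggle_ne (ne_of_mem_of_not_mem hj ht.2) _ _
      have q3 : e (toggle t φ b) a = xor (b a) (agreeOn p (unionList (g' :: gs)) b) := by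
        rw [he1, q2, toggle_ne hta.symm]
      have q4 : φ (e (toggle t φ b)) =
          (agreeOn p g b && xor (b a) (agreeOn p (unionList (g' :: gs)) b)) := by
        simp only [hφ] at q1 q3 ⊢
        rw [q1, q3]
      simp only [Function.comp_apply]
      rw [toggle_self, he2 _ t htA, toggle_self, q4, hU, agreeOn_union]
      simp only [hφ]
      cases b t <;> cases b a <;> cases agreeOn p g b <;>
        cases agreeOn p (unionList (g' :: gs)) b <;> rfl
    · have hjt : j ≠ t := fun h => hj (by simp [h])
      simp only [Function.comp_apply]
      rw [toggle_ne hjt, he2 _ _ (fun hm => hj (List.mem_cons_of_mem _ hm)), toggle_ne hjt]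
    · have hzt : z ≠ t := fun h => hz (by simp [h])
      have hza : z ≠ a := fun h => hz (by simp [h])
      have hzA : z ∉ a :: A := fun h => hz (List.mem_cons_of_mem _ h)
      rw [unionList, Finset.mem_union, not_or] at hz'
      have hφz : ∀ b, φ (Function.update b z v) = φ b := fun b => by
        simp only [hφ, Function.update_of_ne hza.symm]
        rw [agreeOn_congr p fun j hj => Function.update_of_ne (ne_of_mem_of_not_mem hj hz'.1) _ _]
      simp only [Function.comp_apply]
      rw [toggle_update t z hzt v φ b (hφz b), he3 _ _ _ hzA hz'.2,
        toggle_update t z hzt v φ _ (hφz _)]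

/-- A flip controlled by groups of at most two wires, with a dirty wire for every group but
one. -/
theorem reachable_toggle_groups (p : ι → Bool) (gs : List (Finset ι)) (hne : gs ≠ [])
    (A : List ι) (t : ι) (hg : ∀ k ∈ gs, k.card ≤ 2) (hA : gs.length ≤ A.length + 1)
    (hnd : (t :: A).Nodup) (hd : ∀ a ∈ t :: A, a ∉ unionList gs) :
    Reachable (28 * gs.length - 25) (toggle t (agreeOn p (unionList gs))) := by
  obtain ⟨g, gs, rfl⟩ := List.exists_cons_of_ne_nil hne
  cases gs with
  | nil =>
    have ht : t ∉ g := by simpa [unionList] using hd t (by simp)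
    simp only [unionList, Finset.union_empty]
    refine (reachable_toggle_agreeOn t g ht p).mono ?_
    have := Nat.pow_le_pow_right (n := 2) (by norm_num) (hg g (by simp))
    simp only [List.length_singleton]
    omega
  | cons g' gs =>
    obtain ⟨a, A, rfl⟩ : ∃ a A', A = a :: A' := by
      cases A with
      | nil => simp at hA
      | cons a A => exact ⟨a, A, rfl⟩
    have hU : unionList (g :: g' :: gs) = g ∪ unionList (g' :: gs) := rfl
    have hta : t ≠ a := fun h => by simp [h] at hnd
    have htA : t ∉ a :: A := (List.nodup_cons.1 hnd).1
    have hd' : ∀ x ∈ t :: a :: A, x ∉ g ∧ x ∉ unionList (g' :: gs) := fun x hx => by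
      have := hd x hx
      rw [unionList] at this
      simpa [not_or] using this
    have ht := hd' t (by simp)
    obtain ⟨e, he, he1, he2, he3⟩ := exists_chain p g' gs A a (fun k hk => hg k (by simp [hk]))
      (by simpa using hA) (List.nodup_cons.1 hnd).2
      (fun x hx => (hd' x (List.mem_cons_of_mem _ hx)).2)
    set φ : (ι → Bool) → Bool := fun b => agreeOn p g b && b a with hφ
    have hr := reachable_toggle_agreeOn_and t a g ht.1 hta (hg g (by simp)) p
    let E : Equiv.Perm (ι → Bool) := Equiv.ofBijective e he.bijective
    have hE : Reachable (14 * gs.length + 3) E.symm := he.inv fun b => E.apply_symm_apply b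
    -- `E.symm` restores the borrowed wires. It ignores `t`, so the accumulated flip of `t` is kept;
    -- this is what the commutation property `he3` is for.
    have hall : (E.symm ∘ toggle t φ ∘ e ∘ toggle t φ) =
        toggle t (agreeOn p (unionList (g :: g' :: gs))) := by
      funext b
      simp only [Function.comp_apply]
      rw [Equiv.symm_apply_eq]
      change _ = e _
      have h1 : toggle t φ b = Function.update b t (xor (b t) (φ b)) := rfl
      rw [h1, he3 _ _ _ htA ht.2]
      conv_rhs => rw [toggle, he3 _ _ _ htA ht.2]
      rw [toggle, Function.update_self, Function.update_idem]
      congr 1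
      have q1 : ∀ v, agreeOn p g (Function.update (e b) t v) = agreeOn p g b := fun v => by
        refine agreeOn_congr p fun j hj => ?_
        rw [Function.update_of_ne (ne_of_mem_of_not_mem hj ht.1), he2]
        exact fun hm => (hd' j (List.mem_cons_of_mem _ hm)).1 hj
      simp only [hφ, q1]
      rw [Function.update_of_ne hta.symm, he1, hU, agreeOn_union]
      cases b t <;> cases b a <;> cases agreeOn p g b <;>
        cases agreeOn p (unionList (g' :: gs)) b <;> rfl
    rw [← hall]
    -- With two or more groups the count is `28 * L - 36` for `L` groups; the constant `25` in the
    -- bound is what a single group, costing `3`, allows.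
    refine (((hr.comp he).comp hr).comp hE).mono ?_
    simp only [List.length_cons]
    omega

theorem exists_groups {ι : Type} [DecidableEq ι] (K : Finset ι) : ∃ gs : List (Finset ι),
    unionList gs = K ∧ gs.length = (K.card + 1) / 2 ∧ ∀ g ∈ gs, g.card ≤ 2 := by
  induction K using Finset.strongInduction with
  | H K ih =>
    rcases Nat.lt_or_ge K.card 2 with h | h
    · rcases Nat.eq_zero_or_pos K.card with h0 | h0
      · exact ⟨[], by simp [unionList, Finset.card_eq_zero.1 h0], by simp [h0], by simp⟩
      · exact ⟨[K], by simp [unionList], by simp; omega, by simp; omega⟩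
    · obtain ⟨g, hgK, hg⟩ := Finset.exists_subset_card_eq h
      obtain ⟨gs, h1, h2, h3⟩ := ih (K \ g) (Finset.sdiff_ssubset hgK
        (Finset.card_pos.1 (by omega)))
      rw [Finset.card_sdiff_of_subset hgK] at h2
      refine ⟨g :: gs, by rw [unionList, h1, Finset.union_sdiff_of_subset hgK],
        by rw [List.length_cons]; omega, ?_⟩
      simpa [hg] using h3

/-- A flip with `k` controls and `⌈k / 2⌉ - 1` dirty wires `A`. -/
theorem reachable_toggle_dirty (p : ι → Bool) (K A : Finset ι) (t : ι) (hK : K.Nonempty)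
    (htK : t ∉ K) (htA : t ∉ A) (hKA : Disjoint K A) (hA : (K.card + 1) / 2 ≤ A.card + 1) :
    Reachable (28 * ((K.card + 1) / 2) - 25) (toggle t (agreeOn p K)) := by
  obtain ⟨gs, h1, h2, h3⟩ := exists_groups K
  have hpos := hK.card_pos
  rw [← h2, ← h1]
  refine reachable_toggle_groups p gs (fun h => ?_) A.toList t h3 ?_ ?_ ?_
  · rw [h] at h2
    simp only [List.length_nil] at h2
    omega
  · rwa [h2, Finset.length_toList]
  · simpa [htA] using A.nodup_toList
  · intro a ha
    rw [h1]
    rcases List.mem_cons.1 ha with rfl | ha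
    · exact htK
    · exact Finset.disjoint_right.1 hKA (by simpa using ha)

/-- A flip with at least four controls and a single dirty wire `a`. -/
theorem reachable_toggle_one_dirty (p : ι → Bool) (K : Finset ι) (a t : ι) (hK : 4 ≤ K.card)
    (htK : t ∉ K) (haK : a ∉ K) (hat : a ≠ t) :
    Reachable (28 * K.card - 16) (toggle t (agreeOn p K)) := by
  -- The controls are halved: each half serves as the supply of dirty wires for the flip controlled
  -- by the other.
  obtain ⟨K₁, hK₁, hc⟩ := Finset.exists_subset_card_eq (s := K) (n := (K.card + 1) / 2) (by omega)
  set K₂ := K \ K₁ with hK₂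
  have hc2 : K₂.card = K.card - (K.card + 1) / 2 := by
    rw [hK₂, Finset.card_sdiff_of_subset hK₁, hc]
  have hU : K₁ ∪ K₂ = K := Finset.union_sdiff_of_subset hK₁
  have hD : Disjoint K₁ K₂ := Finset.disjoint_sdiff
  have ht1 : t ∉ K₁ := fun h => htK (hK₁ h)
  have ha1 : a ∉ K₁ := fun h => haK (hK₁ h)
  have ht2 : t ∉ K₂ := fun h => htK (Finset.sdiff_subset h)
  have ha2 : a ∉ K₂ := fun h => haK (Finset.sdiff_subset h)
  set p' := Function.update p a true with hp'
  have hins : ∀ b, agreeOn p' (insert a K₂) b = (b a && agreeOn p K₂ b) := by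
    intro b
    have : (b a && agreeOn p K₂ b) = decide (b a = true ∧ ∀ j ∈ K₂, b j = p j) := by
      rw [Bool.decide_and, Bool.decide_eq_true, agreeOn]
    rw [this, agreeOn]
    congr 1
    simp only [Finset.mem_insert, forall_eq_or_imp, hp', Function.update_self]
    refine propext (and_congr_right fun _ => forall₂_congr fun j hj => ?_)
    rw [Function.update_of_ne (ne_of_mem_of_not_mem hj ha2)]
  have r1 := reachable_toggle_dirty p K₁ K₂ a (Finset.card_pos.1 (by omega)) ha1 ha2 hD (by omega)
  have hci : (insert a K₂).card = K₂.card + 1 := Finset.card_insert_of_notMem ha2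
  have r2 := reachable_toggle_dirty p' (insert a K₂) K₁ t (by simp) (by simp [ht2, hat.symm]) ht1
    (by
      rw [Finset.disjoint_insert_left]
      exact ⟨ha1, hD.symm⟩) (by omega)
  -- A commutator: `t` is flipped with the old and with the changed value of `a`, so its net flip is
  -- the conjunction of both halves, and `a` is flipped back.
  have hall : toggle a (agreeOn p K₁) ∘ toggle t (agreeOn p' (insert a K₂)) ∘
      toggle a (agreeOn p K₁) ∘ toggle t (agreeOn p' (insert a K₂)) =
        toggle t (agreeOn p K) := by
    have c1 : ∀ (b : ι → Bool) φ, agreeOn p K₁ (toggle t φ b) = agreeOn p K₁ b := fun b φ =>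
      agreeOn_congr p fun j hj => toggle_ne (ne_of_mem_of_not_mem hj ht1) _ _
    have c1' : ∀ (b : ι → Bool) φ, agreeOn p K₁ (toggle a φ b) = agreeOn p K₁ b := fun b φ =>
      agreeOn_congr p fun j hj => toggle_ne (ne_of_mem_of_not_mem hj ha1) _ _
    have c2 : ∀ (b : ι → Bool) φ, agreeOn p K₂ (toggle t φ b) = agreeOn p K₂ b := fun b φ =>
      agreeOn_congr p fun j hj => toggle_ne (ne_of_mem_of_not_mem hj ht2) _ _
    have c2' : ∀ (b : ι → Bool) φ, agreeOn p K₂ (toggle a φ b) = agreeOn p K₂ b := fun b φ =>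
      agreeOn_congr p fun j hj => toggle_ne (ne_of_mem_of_not_mem hj ha2) _ _
    funext b
    ext j
    simp only [Function.comp_apply]
    by_cases hja : j = a
    · subst hja
      simp only [toggle_self, toggle_ne hat, c1, c1']
      cases b j <;> cases agreeOn p K₁ b <;> rfl
    · rw [toggle_ne hja]
      by_cases hjt : j = t
      · subst hjt
        simp only [toggle_self, toggle_ne hat.symm, toggle_ne hat, c1, c2, c2', hins]
        rw [← hU, agreeOn_union]
        cases b j <;> cases b a <;> cases agreeOn p K₁ b <;> cases agreeOn p K₂ b <;> rfl
      · rw [toggle_ne hjt, toggle_ne hja, toggle_ne hjt, toggle_ne hjt]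
  rw [← hall]
  -- The constant `16` is attained when the number of controls is `1` modulo `4`.
  refine (((r2.comp r1).comp r2).comp r1).mono ?_
  rw [hci, hc2, hc]
  omega

end MultiControlled

/-! ### Pivoting a sparse set of basis states -/

section Pivoting

variable {ι : Type} [Fintype ι] [DecidableEq ι]

/-- The basis state `b` vanishes on all wires outside of `K`. -/
def SupportedOn {ι : Type} (K : Finset ι) (b : ι → Bool) : Prop := ∀ j, j ∉ K → b j = false

instance (K : Finset ι) : DecidablePred (SupportedOn K) := fun b =>
  inferInstanceAs (Decidable (∀ j, j ∉ K → b j = false))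

theorem two_pow_card_le_card_supportedOn (K : Finset ι) :
    2 ^ K.card ≤ (Finset.univ.filter (SupportedOn K)).card := by
  rw [← Finset.card_powerset]
  refine Finset.card_le_card_of_injOn (fun L j => decide (j ∈ L)) (fun L hL => ?_)
    fun L _ L' _ h => ?_
  · have hL' := Finset.mem_powerset.1 hL
    simp only [Finset.coe_filter, Finset.mem_univ, true_and, Set.mem_ofPred_eq]
    exact fun j hj => by simpa using fun h => hj (hL' h)
  · ext j
    simpa using congrFun h j

theorem reachable_fanout (q : ι) (J : Finset ι) (hq : q ∉ J) :
    Reachable J.card fun (b : ι → Bool) j => xor (b j) (b q && decide (j ∈ J)) := by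
  induction J using Finset.induction_on with
  | empty =>
    have : (fun (b : ι → Bool) j => xor (b j) (b q && decide (j ∈ (∅ : Finset ι)))) = id := by
      funext b j
      simp
    rw [this]
    exact Reachable.id
  | insert k J hk ih =>
    have hqk : q ≠ k := fun h => hq (by simp [h])
    have hqJ : q ∉ J := fun h => hq (by simp [h])
    have h1 := reachable_toggle k {q} (by simpa using hqk.symm) (fun b => b q)
      fun b b' h => h q (by simp)
    rw [Finset.card_insert_of_notMem hk]
    refine Eq.mp ?_ ((ih hqJ).comp h1)
    congr 1
    funext b j
    simp only [Function.comp_apply]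
    by_cases hj : j = k
    · subst hj
      rw [toggle_self]
      simp [hk, hqJ]
    · rw [toggle_ne hj]
      simp [hj]

/-- By pigeonhole the target cube has a free place `t`. A fan-out from a wire `q` where `e` is `1`
turns `e` into `t` with the bit `q` set, and a flip of `q` controlled by the pattern `t` clears that
bit. -/
theorem exists_pivot_step (low sys : Finset ι) (hls : low ⊆ sys) (M : ℕ)
    (hM : ∀ q ∈ sys, q ∉ low → ∀ p, Reachable M (toggle q (agreeOn p low)))
    (S : Finset (ι → Bool)) (hS : ∀ s ∈ S, SupportedOn sys s) (hcard : S.card ≤ 2 ^ low.card)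
    (e : ι → Bool) (he : e ∈ S) (heB : ¬ SupportedOn low e) :
    ∃ F, Reachable (sys.card - 1 + M) F ∧ (∀ s ∈ S, SupportedOn sys (F s)) ∧
      ((S.image F).filter fun s => ¬ SupportedOn low s).card <
        (S.filter fun s => ¬ SupportedOn low s).card := by
  obtain ⟨t, htB, htS⟩ : ∃ t, SupportedOn low t ∧ t ∉ S := by
    by_contra! h
    have h1 : Finset.univ.filter (SupportedOn low) ⊂ S := by
      rw [Finset.ssubset_iff_of_subset fun b hb => h b (Finset.mem_filter.1 hb).2]
      exact ⟨e, he, by simpa using heB⟩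
    have := Finset.card_lt_card h1
    have := two_pow_card_le_card_supportedOn low
    omega
  obtain ⟨q, hql, hq⟩ : ∃ q, q ∉ low ∧ e q = true := by
    simpa [SupportedOn] using heB
  have hqs : q ∈ sys := by
    by_contra h
    rw [hS e he q h] at hq
    exact absurd hq (by simp)
  have hts : SupportedOn sys t := fun j hj => htB j fun h => hj (hls h)
  set J := (sys.erase q).filter fun j => e j ≠ t j with hJ
  have hqJ : q ∉ J := by simp [hJ]
  set L : (ι → Bool) → ι → Bool := fun b j => xor (b j) (b q && decide (j ∈ J)) with hL
  have hLr : Reachable (sys.card - 1) L := by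
    refine (reachable_fanout q J hqJ).mono ?_
    rw [← Finset.card_erase_of_mem hqs]
    exact Finset.card_filter_le _ _
  set F := toggle q (agreeOn t low) ∘ L with hF
  -- States already in place have `q = 0`, so the fan-out ignores them; being different from the
  -- free place `t`, they do not trigger the flip either.
  have hFB : ∀ s ∈ S, SupportedOn low s → F s = s := by
    intro s hs hsB
    have hLs : L s = s := by
      funext j
      simp [hL, hsB q hql]
    rw [hF, Function.comp_apply, hLs]
    have hag : agreeOn t low s = false := by
      rw [agreeOn, decide_eq_false_iff_not]
      intro h
      refine htS ?_
      convert hs using 1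
      funext j
      by_cases hj : j ∈ low
      · exact (h j hj).symm
      · rw [hsB j hj, htB j hj]
    funext j
    by_cases hj : j = q
    · subst hj
      rw [toggle_self, hag, Bool.xor_false]
    · rw [toggle_ne hj]
  have hLe : ∀ j, j ≠ q → L e j = t j := by
    intro j hj
    simp only [hL, hq, Bool.true_and]
    by_cases hjs : j ∈ sys
    · have : j ∈ J ↔ e j ≠ t j := by simp [hJ, hj, hjs]
      simp only [this]
      cases e j <;> cases t j <;> rfl
    · have : j ∉ J := by simp [hJ, hjs]
      simp [this, hS e he j hjs, hts j hjs]
  have hLq : ∀ b, L b q = b q := fun b => by simp [hL, hqJ]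
  have hFe : F e = t := by
    have hag : agreeOn t low (L e) = true := by
      rw [agreeOn, decide_eq_true_iff]
      exact fun j hj => hLe j (ne_of_mem_of_not_mem hj hql)
    funext j
    rw [hF, Function.comp_apply]
    by_cases hj : j = q
    · subst hj
      rw [toggle_self, hag, hLq, hq, htB j hql]
      rfl
    · rw [toggle_ne hj, hLe j hj]
  refine ⟨F, hLr.comp (hM q hqs hql t), fun s hs j hj => ?_, ?_⟩
  · have hjq : j ≠ q := fun h => hj (h ▸ hqs)
    have hjJ : j ∉ J := by simp [hJ, hj]
    rw [hF, Function.comp_apply, toggle_ne hjq]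
    simp [hL, hjJ, hS s hs j hj]
  · rw [Finset.filter_image]
    refine Finset.card_image_le.trans_lt (Finset.card_lt_card ?_)
    rw [Finset.ssubset_iff_of_subset]
    · refine ⟨e, by simp [he, heB], by simp [hFe, htB]⟩
    · intro s hs
      rw [Finset.mem_filter] at hs ⊢
      exact ⟨hs.1, fun h => hs.2 (by rwa [hFB s hs.1 h])⟩

theorem exists_pivot (low sys : Finset ι) (hls : low ⊆ sys) (M : ℕ)
    (hM : ∀ q ∈ sys, q ∉ low → ∀ p, Reachable M (toggle q (agreeOn p low)))
    (S : Finset (ι → Bool)) (hS : ∀ s ∈ S, SupportedOn sys s) (hcard : S.card ≤ 2 ^ low.card) :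
    ∃ F, Reachable (2 ^ low.card * (sys.card - 1 + M)) F ∧ ∀ s ∈ S, SupportedOn low (F s) := by
  suffices h : ∀ u, (S.filter fun s => ¬ SupportedOn low s).card ≤ u →
      ∃ F, Reachable (u * (sys.card - 1 + M)) F ∧ ∀ s ∈ S, SupportedOn low (F s) from
    h _ ((Finset.card_filter_le _ _).trans hcard)
  intro u
  induction u generalizing S with
  | zero =>
    intro hu
    refine ⟨id, Reachable.id.mono (Nat.zero_le _), fun s hs => ?_⟩
    by_contra h
    have : s ∈ S.filter fun s => ¬ SupportedOn low s := by simp [hs]; exact h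
    rw [Finset.card_eq_zero.1 (Nat.le_zero.1 hu)] at this
    simp at this
  | succ u ih =>
    intro hu
    by_cases hall : ∀ s ∈ S, SupportedOn low s
    · exact ⟨id, Reachable.id.mono (Nat.zero_le _), hall⟩
    · push Not at hall
      obtain ⟨e, he, heB⟩ := hall
      obtain ⟨F, hF, hFs, hlt⟩ := exists_pivot_step low sys hls M hM S hS hcard e he heB
      obtain ⟨G, hG, hGs⟩ := ih (S.image F) (by simpa using hFs)
        (Finset.card_image_le.trans hcard) (by omega)
      refine ⟨G ∘ F, (hF.comp hG).mono (le_of_eq (by ring)), fun s hs => ?_⟩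
      exact hGs _ (Finset.mem_image_of_mem _ hs)

end Pivoting

/-! ### Circuits on registers with ancillas -/

section Registers

/-- The basis state with all bits zero. -/
abbrev zeroBits (k : ℕ) : Fin k → Bool := fun _ => false

theorem forall_joinBits {n c d : ℕ} {p : (Wires n c d → Bool) → Prop}
    (h : ∀ a z w, p (joinBits a z w)) (b : Wires n c d → Bool) : p b := by
  have : b = joinBits (fun i => b (.inl i)) (fun i => b (.inr (.inl i)))
      fun i => b (.inr (.inr i)) := by
    funext j
    rcases j with j | j | j <;> rfl
  rw [this]
  exact h _ _ _

theorem joinBits_inj {n c d : ℕ} {a a' : Fin n → Bool} {z z' : Fin c → Bool}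
    {w w' : Fin d → Bool} :
    joinBits a z w = joinBits a' z' w' ↔ a = a' ∧ z = z' ∧ w = w' := by
  refine ⟨fun h => ⟨funext fun i => congrFun h (.inl i), funext fun i => congrFun h (.inr (.inl i)),
    funext fun i => congrFun h (.inr (.inr i))⟩, ?_⟩
  rintro ⟨rfl, rfl, rfl⟩
  rfl

theorem implements_iff_sends {n m c d : ℕ} {C : QCircuit (Wires n c d)}
    {V : Matrix (Fin n → Bool) (Fin m → Bool) ℂ} {f : (Fin m → Bool) → Fin n → Bool}
    {z : (Fin m → Bool) → ℂ} (hV : ∀ a x, V a x = if a = f x then z x else 0) :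
    Implements c d C V ↔ ∀ x y, C.Sends (joinBits (padZero n x) (zeroBits c) y) (z x)
      (joinBits (f x) (zeroBits c) y) := by
  have key : ∀ (x : Fin m → Bool) (y : Fin d → Bool) (a : Fin n → Bool) (u : Fin c → Bool)
      (w : Fin d → Bool), (if u = zeroBits c ∧ w = y then V a x else 0) =
      if joinBits a u w = joinBits (f x) (zeroBits c) y then z x else 0 := by
    intro x y a u w
    rw [hV, ← ite_and]
    congr 1
    rw [joinBits_inj]
    exact propext (by tauto)
  constructor
  · intro h x y b
    induction b using forall_joinBits with
    | h a u w => rw [h x y a u w, key]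
  · intro h x y a u w
    rw [h x y _, ← key]

theorem cnotCost_le {n m c d k : ℕ} {C : QCircuit (Wires n c d)}
    {V : Matrix (Fin n → Bool) (Fin m → Bool) ℂ} (h : Implements c d C V) (hC : C.cnotCount ≤ k) :
    cnotCost c d V ≤ (k : ℕ∞) :=
  (iInf₂_le C h).trans (by exact_mod_cast hC)

/-- With this matrix convention `permGate σ` sends `|b⟩` to `|σ⁻¹ b⟩`, which is the origin of the
`symm` in the maps of basis states that follow. -/
theorem permGate_apply {n : ℕ} (σ : Equiv.Perm (Fin n → Bool)) (a b : Fin n → Bool) :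
    permGate σ a b = if a = σ.symm b then 1 else 0 := by
  simp [permGate, Equiv.Perm.permMatrix, PEquiv.toMatrix_apply, Equiv.eq_symm_apply, eq_comm]

theorem permDiagIsometry_apply {n m : ℕ} (σ : Equiv.Perm (Fin n → Bool))
    (δ : (Fin m → Bool) → Circle) (a : Fin n → Bool) (x : Fin m → Bool) :
    (permGate σ * idIsometry n m * diagGate δ) a x =
      if a = σ.symm (padZero n x) then (δ x : ℂ) else 0 := by
  rw [diagGate, Matrix.mul_diagonal]
  simp [Matrix.mul_apply, idIsometry, permGate_apply]

theorem diagGate_mul_permGate_apply {n : ℕ} (σ : Equiv.Perm (Fin n → Bool))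
    (δ : (Fin n → Bool) → Circle) (a b : Fin n → Bool) :
    (diagGate δ * permGate σ) a b = if a = σ.symm b then (δ (σ.symm b) : ℂ) else 0 := by
  rw [diagGate, Matrix.diagonal_mul, permGate_apply]
  split_ifs with h
  · rw [h, mul_one]
  · simp

theorem diagGate_apply {n : ℕ} (δ : (Fin n → Bool) → Circle) (a b : Fin n → Bool) :
    diagGate δ a b = if a = b then (δ b : ℂ) else 0 := by
  rw [diagGate, Matrix.diagonal_apply]
  split_ifs with h
  · rw [h]
  · rfl

theorem padZero_self {n : ℕ} (x : Fin n → Bool) : padZero n x = x := by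
  funext i
  simp [padZero]

theorem padZero_castLE {n m : ℕ} (h : m ≤ n) (x : Fin m → Bool) (i : Fin m) :
    padZero n x (Fin.castLE h i) = x i := by
  simp [padZero]

theorem padZero_injective {n m : ℕ} (h : m ≤ n) :
    Function.Injective (padZero n : (Fin m → Bool) → Fin n → Bool) := fun x x' e =>
  funext fun i => by rw [← padZero_castLE h x, e, padZero_castLE]

/-- The wires of the `m` least significant system qubits. -/
def lowWires {n m : ℕ} (h : m ≤ n) (c d : ℕ) : Fin m ↪ Wires n c d :=
  (Fin.castLEEmb h).trans Function.Embedding.inl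

theorem joinBits_comp_lowWires {n m c d : ℕ} (h : m ≤ n) (a : Fin n → Bool) (z : Fin c → Bool)
    (w : Fin d → Bool) : joinBits a z w ∘ lowWires h c d = fun i => a (Fin.castLE h i) := rfl

theorem joinBits_eq_of_notMem_lowWires {n m c d : ℕ} (h : m ≤ n) (x x' : Fin m → Bool)
    (z : Fin c → Bool) (w : Fin d → Bool) (k : Wires n c d)
    (hk : k ∉ Set.range (lowWires h c d)) :
    joinBits (padZero n x) z w k = joinBits (padZero n x') z w k := by
  rcases k with k | k
  · have : ¬ (k : ℕ) < m := fun hkm => hk ⟨⟨k, hkm⟩, rfl⟩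
    simp [joinBits, padZero, this]
  · rfl

theorem extend_lowWires {n m c d : ℕ} (h : m ≤ n) (x x' : Fin m → Bool)
    (z : Fin c → Bool) (w : Fin d → Bool) :
    Function.extend (lowWires h c d) x' (joinBits (padZero n x) z w) =
      joinBits (padZero n x') z w := by
  funext k
  by_cases hk : k ∈ Set.range (lowWires h c d)
  · obtain ⟨i, rfl⟩ := hk
    rw [(lowWires h c d).injective.extend_apply]
    exact (padZero_castLE h x' i).symm
  · rw [Function.extend_apply' _ _ _ hk, joinBits_eq_of_notMem_lowWires h x x' z w k hk]

/-- A diagonal gate on the low system qubits corrects the phases. -/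
theorem exists_implements_of_reachable {n m c : ℕ} (d : ℕ) (hm : 1 ≤ m) (h : m ≤ n) {k : ℕ}
    {G : (Wires n c 0 → Bool) → Wires n c 0 → Bool} (hG : Reachable k G)
    {f : (Fin m → Bool) → Fin n → Bool}
    (hf : ∀ x y, G (joinBits (padZero n x) (zeroBits c) y) = joinBits (f x) (zeroBits c) y)
    (δ : (Fin m → Bool) → Circle) {V : Matrix (Fin n → Bool) (Fin m → Bool) ℂ}
    (hV : ∀ a x, V a x = if a = f x then (δ x : ℂ) else 0) :
    ∃ C : QCircuit (Wires n c d), Implements c d C V ∧ C.cnotCount ≤ k + (2 ^ m - 2) := by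
  obtain ⟨C, hC, hC'⟩ := hG
  -- Without dirty wires `Fin.elim0` is the only dirty input, so the phase depends on `x` alone.
  -- Dirty ancillas are added afterwards as untouched wires.
  choose z hz hCz using fun x : Fin m → Bool => hC' (joinBits (padZero n x) (zeroBits c) Fin.elim0)
  choose u hu using fun x => (⟨⟨z x, mem_sphere_zero_iff_norm.2 (hz x)⟩, rfl⟩ :
    ∃ u : Circle, (u : ℂ) = z x)
  -- The diagonal gate acts first, while the register still shows `x`: it supplies `δ x` and cancels
  -- the phase that `C` will produce.
  set ω : (Fin m → Bool) → Circle := fun x => δ x * (u x)⁻¹ with hω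
  obtain ⟨D, hD, hD'⟩ := exists_circuit_diagonal (List.finRange m) (List.nodup_finRange m)
    (by rw [← List.length_pos_iff_ne_nil, List.length_finRange]; exact hm)
    (fun x => Complex.arg (ω x)) (fun x x' e => by rw [funext fun j => e j (List.mem_finRange j)])
  rw [List.length_finRange] at hD
  have hDs : ∀ x, D.Sends x (ω x) x := fun x a => by
    rw [hD', Matrix.diagonal_apply, Circle.exp_arg]
    split_ifs with e
    · rw [e]
    · rfl
  let j : Wires n c 0 ↪ Wires n c d := Function.Embedding.sumMap (Function.Embedding.refl _)
    (Function.Embedding.sumMap (Function.Embedding.refl _) Function.Embedding.ofIsEmpty)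
  have hj : ∀ (a : Fin n → Bool) (u : Fin c → Bool) (w : Fin d → Bool),
      joinBits a u w ∘ j = joinBits a u Fin.elim0 := by
    intro a u w
    funext k
    rcases k with k | k | k
    · rfl
    · rfl
    · exact k.elim0
  refine ⟨QCircuit.relabel j (D.relabel (lowWires h c 0) ++ C), ?_, ?_⟩
  · rw [implements_iff_sends hV]
    intro x y
    refine QCircuit.Sends.relabel j ?_ ?_
    · rw [hj, hj]
      have h1 : (D.relabel (lowWires h c 0)).Sends
          (joinBits (padZero n x) (zeroBits c) Fin.elim0) (ω x)
          (joinBits (padZero n x) (zeroBits c) Fin.elim0) := by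
        refine QCircuit.Sends.relabel _ ?_ fun _ _ => rfl
        rw [joinBits_comp_lowWires]
        simp only [padZero_castLE]
        exact hDs x
      have h2 := h1.append (hCz x)
      rw [hf] at h2
      have hz0 : z x ≠ 0 := fun h0 => by simpa [h0] using hz x
      have hzω : z x * (ω x : ℂ) = δ x := by
        rw [hω, Circle.coe_mul, Circle.coe_inv, hu]
        field_simp
      rwa [hzω] at h2
    · intro k hk
      rcases k with k | k | k
      · exact absurd ⟨.inl k, rfl⟩ hk
      · rfl
      · rfl
  · rw [QCircuit.cnotCount_relabel, QCircuit.cnotCount_append, QCircuit.cnotCount_relabel]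
    omega

theorem costPermDiagIsometry_le_of_reachable {n m c : ℕ} (d : ℕ) (hm : 1 ≤ m) (h : m ≤ n) {k : ℕ}
    (H : ∀ f : (Fin m → Bool) → Fin n → Bool, Function.Injective f →
      (∃ σ : Equiv.Perm (Fin n → Bool), ∀ x, f x = σ (padZero n x)) →
      ∃ G : (Wires n c 0 → Bool) → Wires n c 0 → Bool, Reachable k G ∧
        ∀ x y, G (joinBits (padZero n x) (zeroBits c) y) = joinBits (f x) (zeroBits c) y) :
    costPermDiagIsometry c d n m ≤ ((k + (2 ^ m - 2) : ℕ) : ℕ∞) := by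
  refine iSup₂_le fun σ δ => ?_
  obtain ⟨G, hG, hf⟩ := H (fun x => σ.symm (padZero n x))
    (σ.symm.injective.comp (padZero_injective h)) ⟨σ.symm, fun _ => rfl⟩
  obtain ⟨C, hC, hC'⟩ := exists_implements_of_reachable d hm h hG hf δ (permDiagIsometry_apply σ δ)
  exact cnotCost_le hC hC'

theorem costPermDiagIsometry_le_dense {n m : ℕ} (c d : ℕ) (hm : 1 ≤ m) (h : m ≤ n) :
    costPermDiagIsometry c d n m ≤
      (((2 * n - 1) * (2 ^ (n - 1) - 1) + (2 ^ m - 2) : ℕ) : ℕ∞) := by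
  refine costPermDiagIsometry_le_of_reachable d hm h ?_
  rintro f - ⟨σ, hσ⟩
  refine ⟨_, (reachable_perm n σ).relabel (lowWires le_rfl c 0), fun x y => ?_⟩
  rw [hσ, joinBits_comp_lowWires]
  have := extend_lowWires (c := c) (le_refl n) (padZero n x) (σ (padZero n x)) (zeroBits c) y
  rwa [padZero_self, padZero_self] at this

/-- The pivot `F` compresses the image states into the low wires and there induces a permutation `g`
of the inputs. The circuit applies `g` and then undoes `F`; the three summands are pivot, `g` and
phase correction. -/
theorem costPermDiagIsometry_le_sparse {n m c : ℕ} (d : ℕ) (hm : 1 ≤ m) (h : m ≤ n) (M : ℕ)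
    (hM : ∀ q : Fin n, m ≤ (q : ℕ) → ∀ p, Reachable M
      (toggle (.inl q) (agreeOn p (Finset.univ.map (lowWires h c 0))))) :
    costPermDiagIsometry c d n m ≤
      ((2 ^ m * (n - 1 + M) + (2 * m - 1) * (2 ^ (m - 1) - 1) + (2 ^ m - 2) : ℕ) : ℕ∞) := by
  refine costPermDiagIsometry_le_of_reachable d hm h ?_
  rintro f hf -
  set low : Finset (Wires n c 0) := Finset.univ.map (lowWires h c 0) with hlow
  set sys : Finset (Wires n c 0) := Finset.univ.map Function.Embedding.inl with hsys
  have hlc : low.card = m := by simp [hlow]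
  have hsc : sys.card = n := by simp [hsys]
  have hmem : ∀ q : Fin n, (Sum.inl q : Wires n c 0) ∉ low → m ≤ (q : ℕ) := by
    intro q hq
    by_contra hlt
    exact hq (Finset.mem_map.2 ⟨⟨q, by omega⟩, Finset.mem_univ _, rfl⟩)
  set J : (Fin m → Bool) → Wires n c 0 → Bool := fun x =>
    joinBits (f x) (zeroBits c) Fin.elim0 with hJ
  have hJinj : Function.Injective J := fun x x' e => hf (joinBits_inj.1 e).1
  obtain ⟨F, hF, hFs⟩ := exists_pivot low sys
    (by
      intro k hk
      obtain ⟨i, -, rfl⟩ := Finset.mem_map.1 hk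
      exact Finset.mem_map.2 ⟨Fin.castLE h i, Finset.mem_univ _, rfl⟩) M
    (by
      intro q hq hql p
      obtain ⟨q, -, rfl⟩ := Finset.mem_map.1 hq
      exact hM q (hmem q hql) p) (Finset.univ.image J)
    (by
      intro s hs k hk
      obtain ⟨x, -, rfl⟩ := Finset.mem_image.1 hs
      rcases k with k | k | k
      · exact absurd (Finset.mem_map.2 ⟨k, Finset.mem_univ _, rfl⟩) hk
      · rfl
      · exact k.elim0)
    (by
      refine Finset.card_image_le.trans ?_
      rw [hlc, Finset.card_univ, Fintype.card_fun, Fintype.card_bool, Fintype.card_fin])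
  have hsupp : ∀ b : Wires n c 0 → Bool, SupportedOn low b →
      b = joinBits (padZero n (b ∘ lowWires h c 0)) (zeroBits c) Fin.elim0 := by
    intro b hb
    funext k
    rcases k with k | k | k
    · by_cases hk : (k : ℕ) < m
      · simp only [joinBits, Sum.elim_inl, padZero, hk, dif_pos]
        rfl
      · rw [hb]
        · simp [joinBits, padZero, hk]
        · intro hm'
          obtain ⟨i, -, hi⟩ := Finset.mem_map.1 hm'
          have : Fin.castLE h i = k := Sum.inl.inj hi
          exact hk (by rw [← this]; exact i.2)
    · rw [hb]
      · rfl
      · simp [hlow, lowWires]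
    · exact k.elim0
  have hFJ : ∀ x, F (J x) =
      joinBits (padZero n (F (J x) ∘ lowWires h c 0)) (zeroBits c) Fin.elim0 := fun x =>
    hsupp _ (hFs _ (Finset.mem_image_of_mem _ (Finset.mem_univ x)))
  have hginj : Function.Injective fun x => F (J x) ∘ lowWires h c 0 := by
    intro x x' e
    refine hJinj (hF.bijective.injective ?_)
    simp only at e
    rw [hFJ x, hFJ x', e]
  let g : Equiv.Perm (Fin m → Bool) :=
    Equiv.ofBijective _ (Finite.injective_iff_bijective.1 hginj)
  let F' : Equiv.Perm (Wires n c 0 → Bool) := Equiv.ofBijective F hF.bijective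
  have hF' : Reachable _ F'.symm := hF.inv fun b => F'.apply_symm_apply b
  refine ⟨_, (((reachable_perm m g).relabel (lowWires h c 0)).comp hF').mono (le_of_eq ?_),
    fun x y => ?_⟩
  · rw [hlc, hsc]
    ring
  · rw [Function.comp_apply, Equiv.symm_apply_eq, joinBits_comp_lowWires]
    simp only [padZero_castLE]
    rw [extend_lowWires, Subsingleton.elim y Fin.elim0]
    exact (hFJ x).symm

/-! ### Comparison of the CNOT counts with the explicit bounds -/

theorem exists_eq_coe_of_le {x : ℕ∞} {k : ℕ} {B : ℤ} (hx : x ≤ (k : ℕ∞)) (hk : (k : ℤ) ≤ B) :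
    ∃ N : ℕ, x = (N : ℕ∞) ∧ (N : ℤ) ≤ B := by
  obtain ⟨N, hN, hNk⟩ := ENat.le_natCast_iff.1 hx
  exact ⟨N, hN, by omega⟩

/-- The worst case is `n = m + 1`, where the count is below `(2 * m + 1) * 2 ^ m + 2 ^ m`. The case
`n = 2`, `m = 1` is exceptional: the target factor is only `2`, and the exact count `3` is used. -/
theorem dense_count_le {n m : ℕ} (hm : 1 ≤ m) (h : m ≤ n) (hn : n ≤ m + 1) {a : ℤ}
    (ha : if n = 1 then 0 ≤ a else 2 * (m : ℤ) + 2 ≤ a ∨ (n = 2 ∧ m = 1 ∧ 2 ≤ a)) :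
    (((2 * n - 1) * (2 ^ (n - 1) - 1) + (2 ^ m - 2) : ℕ) : ℤ) ≤ a * 2 ^ m := by
  obtain ⟨m, rfl⟩ := Nat.exists_eq_add_of_le' hm
  have hP : (1 : ℤ) ≤ 2 ^ m := one_le_pow₀ (by norm_num)
  have h1 : 1 ≤ 2 ^ m := Nat.one_le_two_pow
  have h2 : 1 ≤ 2 ^ (m + 1) := Nat.one_le_two_pow
  have h3 : 2 ≤ 2 ^ (m + 1) := by rw [pow_succ]; omega
  rcases (by omega : n = m + 1 ∨ n = m + 1 + 1) with rfl | rfl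
  · rw [show m + 1 - 1 = m by omega, show 2 * (m + 1) - 1 = 2 * m + 1 by omega]
    push_cast [Nat.cast_sub h1, Nat.cast_sub h3]
    rw [pow_succ]
    split_ifs at ha with h0
    · obtain rfl : m = 0 := by omega
      simp only [pow_zero]; push_cast; linarith
    · rcases ha with ha | ha
      · push_cast at ha
        nlinarith
      · omega
  · rw [show m + 1 + 1 - 1 = m + 1 by omega, show 2 * (m + 1 + 1) - 1 = 2 * m + 3 by omega]
    push_cast [Nat.cast_sub h2, Nat.cast_sub h3]
    rw [pow_succ]
    rw [if_neg (by omega)] at ha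
    rcases ha with ha | ⟨-, h0, ha⟩
    · push_cast at ha
      nlinarith
    · obtain rfl : m = 0 := by omega
      simp only [pow_zero]; push_cast; linarith

/-- The permutation and phase terms together stay below `(m + 1) * 2 ^ m`. They vanish for `m = 1`,
which the bound without clean ancillas needs, as it is attained there. -/
theorem sparse_count_le {n m M : ℕ} (hm : 1 ≤ m) (hn : 1 ≤ n) {a : ℤ}
    (ha : (n : ℤ) + m + M ≤ a ∨ (m = 1 ∧ (n : ℤ) - 1 + M ≤ a)) :
    ((2 ^ m * (n - 1 + M) + (2 * m - 1) * (2 ^ (m - 1) - 1) + (2 ^ m - 2) : ℕ) : ℤ) ≤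
      a * 2 ^ m := by
  obtain ⟨m, rfl⟩ := Nat.exists_eq_add_of_le' hm
  have hP : (1 : ℤ) ≤ 2 ^ m := one_le_pow₀ (by norm_num)
  have h1 : 1 ≤ 2 ^ m := Nat.one_le_two_pow
  have h3 : 2 ≤ 2 ^ (m + 1) := by rw [pow_succ]; omega
  rw [show m + 1 - 1 = m by omega, show 2 * (m + 1) - 1 = 2 * m + 1 by omega]
  push_cast [Nat.cast_sub h1, Nat.cast_sub h3, Nat.cast_sub hn]
  rw [pow_succ]
  rcases ha with ha | ⟨h0, ha⟩
  · push_cast at ha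
    nlinarith
  · obtain rfl : m = 0 := by omega
    simp only [pow_zero]; push_cast; linarith

/-- The bound without clean ancillas. -/
theorem costPermDiagIsometry_le_no_clean {n m : ℕ} (d : ℕ) (hm : 1 ≤ m) (h : m ≤ n) :
    ∃ N : ℕ, costPermDiagIsometry 0 d n m = (N : ℕ∞) ∧
      (N : ℤ) ≤ ((n : ℤ) + 34 * (m : ℤ) - 34) * 2 ^ m := by
  rcases Nat.lt_or_ge n (m + 2) with hn | hn
  · refine exists_eq_coe_of_le (costPermDiagIsometry_le_dense 0 d hm h)
      (dense_count_le hm h (by omega) ?_)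
    split_ifs <;> omega
  · have hcard : (Finset.univ.map (lowWires h 0 0)).card = m := by simp
    have hnot : ∀ q : Fin n, m ≤ (q : ℕ) →
        (Sum.inl q : Wires n 0 0) ∉ Finset.univ.map (lowWires h 0 0) := by
      intro q hq hm'
      obtain ⟨i, -, hi⟩ := Finset.mem_map.1 hm'
      have : Fin.castLE h i = q := Sum.inl.inj hi
      have := congrArg Fin.val this
      simp only [Fin.val_castLE] at this
      omega
    rcases Nat.lt_or_ge m 4 with hm4 | hm4
    · refine exists_eq_coe_of_le (costPermDiagIsometry_le_sparse d hm h (2 ^ m - 1)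
        fun q hq p => ?_) (sparse_count_le hm (by omega) ?_)
      · have := reachable_toggle_agreeOn _ _ (hnot q hq) p
        rwa [hcard] at this
      · interval_cases m <;> norm_num <;> omega
    -- Since `n ≥ m + 2`, a second high system qubit `b` can serve as the dirty wire. The comparison
    -- `n + 29 * m - 16 ≤ n + 34 * m - 34` holds from `m = 4` on.
    · refine exists_eq_coe_of_le (costPermDiagIsometry_le_sparse d hm h (28 * m - 16)
        fun q hq p => ?_) (sparse_count_le hm (by omega) (by omega))
      obtain ⟨b, hb, hbq⟩ : ∃ b : Fin n, m ≤ (b : ℕ) ∧ b ≠ q := by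
        by_cases hq' : (q : ℕ) = m
        · exact ⟨⟨m + 1, by omega⟩, by simp, fun e => by simp [← e] at hq'⟩
        · exact ⟨⟨m, by omega⟩, le_rfl, fun e => hq' (by simp [← e])⟩
      have := reachable_toggle_one_dirty p _ (.inl b) (.inl q) (by rw [hcard]; exact hm4)
        (hnot q hq) (hnot b hb) fun e => hbq (Sum.inl.inj e)
      rwa [hcard] at this

/-- The bound with `⌈m / 2⌉ - 1` clean ancillas. -/
theorem costPermDiagIsometry_le_clean {n m c : ℕ} (d : ℕ) (hm : 2 ≤ m) (h : m ≤ n)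
    (hc : (m + 1) / 2 ≤ c + 1) :
    ∃ N : ℕ, costPermDiagIsometry c d n m = (N : ℕ∞) ∧
      (N : ℤ) ≤ ((n : ℤ) + 24 * (m : ℤ) - 32) * 2 ^ m := by
  rcases Nat.lt_or_ge n (m + 2) with hn | hn
  · refine exists_eq_coe_of_le (costPermDiagIsometry_le_dense c d (by omega) h)
      (dense_count_le (by omega) h (by omega) ?_)
    split_ifs <;> omega
  · have hcard : (Finset.univ.map (lowWires h c 0)).card = m := by simp
    have hnot : ∀ q : Fin n, m ≤ (q : ℕ) →
        (Sum.inl q : Wires n c 0) ∉ Finset.univ.map (lowWires h c 0) := by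
      intro q hq hm'
      obtain ⟨i, -, hi⟩ := Finset.mem_map.1 hm'
      have : Fin.castLE h i = q := Sum.inl.inj hi
      have := congrArg Fin.val this
      simp only [Fin.val_castLE] at this
      omega
    rcases Nat.lt_or_ge m 3 with hm3 | hm3
    · refine exists_eq_coe_of_le (costPermDiagIsometry_le_sparse d (by omega) h (2 ^ m - 1)
        fun q hq p => ?_) (sparse_count_le (by omega) (by omega) ?_)
      · have := reachable_toggle_agreeOn _ _ (hnot q hq) p
        rwa [hcard] at this
      · interval_cases m
        norm_num
        omega
    -- The clean ancillas play the part of the dirty wires. The relevant factor is at most `n + 15 *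
    -- m - 11`.
    · refine exists_eq_coe_of_le (costPermDiagIsometry_le_sparse d (by omega) h
        (28 * ((m + 1) / 2) - 25) fun q hq p => ?_) (sparse_count_le (by omega) (by omega)
          (by omega))
      have := reachable_toggle_dirty p (Finset.univ.map (lowWires h c 0))
        (Finset.univ.map (Function.Embedding.inl.trans Function.Embedding.inr)) (.inl q)
        (Finset.card_pos.1 (by rw [hcard]; omega)) (hnot q hq) (by simp)
        (by
          rw [Finset.disjoint_left]
          intro k hk hk'
          obtain ⟨i, -, rfl⟩ := Finset.mem_map.1 hk
          simp [lowWires] at hk')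
        (by rw [hcard]; simpa using hc)
      rwa [hcard] at this

end Registers

/-! ### Permuted diagonal isometries from pivoting, permutations and diagonal gates -/

section Decomposition

/-- A finite bound on an infimum in `ℕ∞` is met by some member, because being at most `k` is the
same as being less than `k + 1`. -/
theorem exists_le_of_iInf_le {α : Sort*} {f : α → ℕ∞} {k : ℕ} (h : ⨅ i, f i ≤ (k : ℕ∞)) :
    ∃ i, f i ≤ (k : ℕ∞) := by
  have h1 : ⨅ i, f i < (k : ℕ∞) + 1 := ENat.lt_add_one_iff (ENat.natCast_ne_top k) |>.2 h
  obtain ⟨i, hi⟩ := iInf_lt_iff.1 h1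
  exact ⟨i, (ENat.lt_add_one_iff (ENat.natCast_ne_top k)).1 hi⟩

theorem exists_implements_of_cnotCost_le {n m c d k : ℕ}
    {V : Matrix (Fin n → Bool) (Fin m → Bool) ℂ} (h : cnotCost c d V ≤ (k : ℕ∞)) :
    ∃ C : QCircuit (Wires n c d), Implements c d C V ∧ C.cnotCount ≤ k := by
  obtain ⟨C, h⟩ := exists_le_of_iInf_le h
  obtain ⟨hC, h⟩ := exists_le_of_iInf_le h
  exact ⟨C, hC, by exact_mod_cast h⟩

/-- Bit flips need no CNOT. -/
theorem exists_circuit_flips {ι : Type} [Fintype ι] [DecidableEq ι] (K : Finset ι) :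
    ∃ C : QCircuit ι, C.cnotCount = 0 ∧
      ∀ b, C.Sends b 1 fun j => xor (b j) (decide (j ∈ K)) := by
  induction K using Finset.induction_on with
  | empty =>
    exact ⟨[], rfl, fun b a => by simp [QCircuit.matrix, Matrix.one_apply]⟩
  | insert t K ht ih =>
    obtain ⟨C, hC, hCs⟩ := ih
    have hU : pauliXPow true ∈ Matrix.unitaryGroup Bool ℂ := by
      rw [Matrix.mem_unitaryGroup_iff]
      ext i j
      cases i <;> cases j <;>
        simp [pauliXPow, Matrix.mul_apply, Matrix.star_eq_conjTranspose]
    refine ⟨C ++ [.single t ⟨_, hU⟩], by simp [QCircuit.cnotCount_append, hC, QCircuit.cnotCount],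
      fun b => ?_⟩
    have h1 : ∀ b, QCircuit.Sends [.single t ⟨_, hU⟩] b 1 (toggle t (fun _ => true) b) := by
      intro b a
      simp only [QCircuit.matrix, one_mul, QGate.matrix_single, muxMatrix, Matrix.of_apply,
        pauliXPow]
      rw [← ite_and]
      congr 1
      refine propext ⟨fun ⟨h1, h2⟩ => funext fun j => ?_, ?_⟩
      · by_cases hj : j = t
        · rw [hj, toggle_self, h2]
        · rw [toggle_ne hj, h1 j hj]
      · rintro rfl
        exact ⟨fun j hj => toggle_ne hj _ _, toggle_self _ _ _⟩
    have h2 := (hCs b).append (h1 _)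
    rw [one_mul] at h2
    convert h2 using 1
    funext j
    by_cases hj : j = t
    · subst hj
      simp [toggle_self, ht]
    · simp [toggle_ne hj, hj]

/-- The uniform superposition of the basis states `f x`. -/
noncomputable def uniformState {n m : ℕ} (f : (Fin m → Bool) → Fin n → Bool) :
    (Fin n → Bool) → ℂ := by
  classical
  exact fun a => if a ∈ Set.range f then ((Real.sqrt (2 ^ m))⁻¹ : ℝ) else 0

theorem uniformState_ne_zero {n m : ℕ} (f : (Fin m → Bool) → Fin n → Bool) (a : Fin n → Bool) :
    uniformState f a ≠ 0 ↔ a ∈ Set.range f := by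
  simp [uniformState]

theorem isState_uniformState {n m : ℕ} {f : (Fin m → Bool) → Fin n → Bool}
    (hf : Function.Injective f) : IsState (uniformState f) := by
  rw [IsState, ← Fintype.sum_of_injective f hf (fun _ => ((2 : ℝ) ^ m)⁻¹)]
  · simp
  · intro a ha
    rw [not_not.1 fun h => ha ((uniformState_ne_zero f a).1 h)]
    simp
  · intro x
    simp [uniformState]

theorem nnz_uniformState_le {n m : ℕ} (f : (Fin m → Bool) → Fin n → Bool) :
    nnz (uniformState f) ≤ 2 ^ m := by
  have : {a | uniformState f a ≠ 0} = f '' Set.univ := by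
    ext a
    rw [Set.image_univ]
    exact uniformState_ne_zero f a
  rw [nnz, this]
  refine (Set.ncard_image_le Set.finite_univ).trans ?_
  simp [Set.ncard_univ]

/-- The wires of `m` system qubits with `c + (n - m)` clean ancillas, as wires of `n` system
qubits with `c` clean ancillas. -/
def shiftWires {n m : ℕ} (h : m ≤ n) (c d : ℕ) : Wires m (c + (n - m)) d ↪ Wires n c d where
  toFun
    | .inl i => .inl (Fin.castLE h i)
    | .inr (.inl k) => if hk : (k : ℕ) < c then .inr (.inl ⟨k, hk⟩)
        else .inl ⟨m + (k - c), by omega⟩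
    | .inr (.inr l) => .inr (.inr l)
  inj' := by
    rintro (i | k | l) (i' | k' | l') e
    · simpa using e
    · simp only at e
      split_ifs at e with hk
      · have := congrArg Fin.val (Sum.inl.inj e)
        simp only [Fin.val_castLE] at this
        omega
    · simp at e
    · simp only at e
      split_ifs at e with hk
      · have := congrArg Fin.val (Sum.inl.inj e)
        simp only [Fin.val_castLE] at this
        omega
    · simp only at e
      split_ifs at e with hk hk' hk'
      · have := congrArg Fin.val (Sum.inl.inj (Sum.inr.inj e))
        simp only at this
        congr 2
        exact Fin.ext this
      · have := congrArg Fin.val (Sum.inl.inj e)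
        simp only at this
        congr 2
        exact Fin.ext (by omega)
    · simp only at e
      split_ifs at e with hk
      · simp at e
    · simp at e
    · simp only at e
      split_ifs at e with hk
      · simp at e
    · simpa using e

theorem joinBits_comp_shiftWires {n m c d : ℕ} (h : m ≤ n) (x : Fin m → Bool)
    (y : Fin d → Bool) : joinBits (padZero n x) (zeroBits c) y ∘ shiftWires h c d =
      joinBits x (zeroBits (c + (n - m))) y := by
  funext k
  rcases k with i | k | l
  · exact padZero_castLE h x i
  · have hs : shiftWires h c d (.inr (.inl k)) = if hk : (k : ℕ) < c then .inr (.inl ⟨k, hk⟩)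
        else .inl ⟨m + (k - c), by omega⟩ := rfl
    rw [Function.comp_apply, hs]
    split_ifs with hk
    · rfl
    · simp [joinBits, padZero]
  · rfl

theorem QCircuit.Sends.relabel_shiftWires {n m c d : ℕ} (h : m ≤ n)
    {C : QCircuit (Wires m (c + (n - m)) d)} {x x' : Fin m → Bool} {y : Fin d → Bool} {z : ℂ}
    (hC : C.Sends (joinBits x (zeroBits _) y) z (joinBits x' (zeroBits _) y)) :
    (C.relabel (shiftWires h c d)).Sends (joinBits (padZero n x) (zeroBits c) y) z
      (joinBits (padZero n x') (zeroBits c) y) := by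
  refine QCircuit.Sends.relabel _ ?_ fun k hk => ?_
  · rwa [joinBits_comp_shiftWires, joinBits_comp_shiftWires]
  · refine joinBits_eq_of_notMem_lowWires h x' x _ _ k fun ⟨i, hi⟩ => hk ⟨.inl i, hi⟩

theorem cnotCost_permDiagIsometry_le {n m : ℕ} (h : m ≤ n) (c d : ℕ)
    (σ : Equiv.Perm (Fin n → Bool)) (δ : (Fin m → Bool) → Circle) :
    cnotCost c d (permGate σ * idIsometry n m * diagGate δ) ≤
      costPivUpToDiag c d h + costPermUpToDiag (c + (n - m)) d m
        + costDiag (c + (n - m)) d m := by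
  rcases eq_or_ne (costPivUpToDiag c d h) ⊤ with hP | hP
  · simp [hP]
  rcases eq_or_ne (costPermUpToDiag (c + (n - m)) d m) ⊤ with hQ | hQ
  · simp [hQ]
  rcases eq_or_ne (costDiag (c + (n - m)) d m) ⊤ with hR | hR
  · simp [hR]
  obtain ⟨P, hP⟩ := ENat.ne_top_iff_exists.1 hP
  obtain ⟨Q, hQ⟩ := ENat.ne_top_iff_exists.1 hQ
  obtain ⟨R, hR⟩ := ENat.ne_top_iff_exists.1 hR
  -- The uniform state on the range of `f` is the one to pivot: its support is exactly the set of
  -- basis states that the isometry reaches.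
  set f : (Fin m → Bool) → Fin n → Bool := fun x => σ.symm (padZero n x) with hf
  have hfinj : Function.Injective f := σ.symm.injective.comp (padZero_injective h)
  have hpiv : ⨅ (τ : Equiv.Perm (Fin n → Bool)) (_ : Pivots h τ (uniformState f))
      (δ : (Fin n → Bool) → Circle), cnotCost c d (diagGate δ * permGate τ) ≤ (P : ℕ∞) := by
    rw [hP]
    exact le_iSup_of_le (uniformState f) (le_iSup₂_of_le (isState_uniformState hfinj)
      (nnz_uniformState_le f) le_rfl)
  obtain ⟨τ, hpiv⟩ := exists_le_of_iInf_le hpiv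
  obtain ⟨⟨i, w, -, hw⟩, hpiv⟩ := exists_le_of_iInf_le hpiv
  obtain ⟨δ₁, hpiv⟩ := exists_le_of_iInf_le hpiv
  obtain ⟨C₁, hC₁, hP₁⟩ := exists_implements_of_cnotCost_le hpiv
  -- The pivoted state has the nonzero amplitude of `f x` at `τ.symm (f x)`, whereas it vanishes
  -- wherever the high bits differ from `i`.
  have hhigh : ∀ x (k : Fin (n - m)), τ.symm (f x) ⟨m + k, by omega⟩ = i k := by
    intro x
    by_contra hne
    have h1 := congrFun hw (τ.symm (f x))
    rw [blockVec, if_neg hne] at h1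
    refine (uniformState_ne_zero f (f x)).2 ⟨x, rfl⟩ ?_
    rw [← h1]
    simp [Matrix.mulVec, dotProduct, permGate_apply]
  -- These are the high system wires to be flipped from `0` to the block label `i`, at no CNOT cost.
  set K : Finset (Wires n c d) := Finset.univ.filter fun k => ∃ j : Fin (n - m),
    i j = true ∧ k = .inl ⟨m + j, by omega⟩ with hK
  set g₀ : (Fin m → Bool) → Fin m → Bool := fun x k => τ.symm (f x) (Fin.castLE h k) with hg₀
  have hflip : ∀ x y, (fun j => xor (joinBits (padZero n (g₀ x)) (zeroBits c) y j)
      (decide (j ∈ K))) = joinBits (τ.symm (f x)) (zeroBits c) y := by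
    intro x y
    funext k
    rcases k with k | k
    · by_cases hk : (k : ℕ) < m
      · have hkK : (Sum.inl k : Wires n c d) ∉ K := by
          simp only [hK, Finset.mem_filter, Finset.mem_univ, true_and, not_exists, not_and]
          intro j _ e
          have := congrArg Fin.val (Sum.inl.inj e)
          simp only at this
          omega
        simp only [hkK, decide_false, Bool.xor_false, joinBits, Sum.elim_inl, padZero, hk,
          dif_pos, hg₀]
        rfl
      · obtain ⟨j, hj⟩ : ∃ j : Fin (n - m), k = ⟨m + j, by omega⟩ :=
          ⟨⟨k - m, by omega⟩, Fin.ext (by simp only; omega)⟩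
        have hkK : (Sum.inl k : Wires n c d) ∈ K ↔ i j = true := by
          simp only [hK, Finset.mem_filter, Finset.mem_univ, true_and]
          constructor
          · rintro ⟨j', hj', e⟩
            have := congrArg Fin.val ((Sum.inl.inj e).symm.trans hj)
            simp only at this
            obtain rfl : j' = j := Fin.ext (by omega)
            exact hj'
          · exact fun hij => ⟨j, hij, by rw [hj]⟩
        simp only [hkK, joinBits, Sum.elim_inl, padZero, hk, dif_neg, not_false_eq_true,
          Bool.false_xor]
        rw [hj, hhigh]
        simp
    · have hkK : (Sum.inr k : Wires n c d) ∉ K := by simp [hK]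
      simp only [hkK, decide_false, Bool.xor_false]
      rfl
  have hginj : Function.Injective g₀ := by
    intro x x' e
    have h1 := (hflip x (fun _ => false)).symm
    rw [e, hflip x', joinBits_inj] at h1
    exact hfinj (τ.symm.injective h1.1)
  let g : Equiv.Perm (Fin m → Bool) := Equiv.ofBijective g₀ (Finite.injective_iff_bijective.1 hginj)
  have hperm : ⨅ δ : (Fin m → Bool) → Circle,
      cnotCost (c + (n - m)) d (diagGate δ * permGate g.symm) ≤ (Q : ℕ∞) := by
    rw [hQ]
    exact le_iSup (fun σ : Equiv.Perm (Fin m → Bool) => ⨅ δ : (Fin m → Bool) → Circle,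
      cnotCost (c + (n - m)) d (diagGate δ * permGate σ)) g.symm
  obtain ⟨δ₂, hperm⟩ := exists_le_of_iInf_le hperm
  obtain ⟨C₂, hC₂, hQ₂⟩ := exists_implements_of_cnotCost_le hperm
  -- The phase `δ₂` of the permutation circuit is cancelled, while `δ₁` enters uninverted because
  -- the pivoting circuit is run backwards.
  set δ₃ : (Fin m → Bool) → Circle := fun x =>
    δ x * (δ₂ (g₀ x))⁻¹ * δ₁ (τ.symm (f x)) with hδ₃
  have hdiag : cnotCost (c + (n - m)) d (diagGate δ₃) ≤ (R : ℕ∞) := by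
    rw [hR]
    exact le_iSup (fun δ : (Fin m → Bool) → Circle => cnotCost (c + (n - m)) d (diagGate δ)) δ₃
  obtain ⟨C₃, hC₃, hR₃⟩ := exists_implements_of_cnotCost_le hdiag
  rw [implements_iff_sends (diagGate_mul_permGate_apply τ δ₁)] at hC₁
  rw [implements_iff_sends (diagGate_mul_permGate_apply g.symm δ₂)] at hC₂
  rw [implements_iff_sends (f := id) (diagGate_apply δ₃)] at hC₃
  simp only [padZero_self] at hC₁ hC₂ hC₃
  obtain ⟨X, hX, hXs⟩ := exists_circuit_flips K
  rw [← hP, ← hQ, ← hR]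
  -- On basis states the path is `x`, then `g₀ x` on the low wires, then `τ.symm (f x)` after the
  -- flips, then `f x`. During the first two circuits the high system wires are still `0` and act as
  -- clean ancillas.
  have himpl : Implements c d (QCircuit.relabel (shiftWires h c d) C₃ ++
      (QCircuit.relabel (shiftWires h c d) C₂ ++ (X ++ C₁.inv)))
      (permGate σ * idIsometry n m * diagGate δ) := by
    rw [implements_iff_sends (permDiagIsometry_apply σ δ)]
    intro x y
    have s₃ := (hC₃ x y).relabel_shiftWires h
    have s₂ := (hC₂ x y).relabel_shiftWires h
    have sX := hXs (joinBits (padZero n (g₀ x)) (zeroBits c) y)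
    rw [hflip] at sX
    have s₁ := (hC₁ (f x) y).inv (Circle.coe_ne_zero _)
    have s := s₃.append (s₂.append (sX.append s₁))
    convert s using 1
    rw [hδ₃]
    simp only [Circle.coe_mul, Circle.coe_inv, mul_one]
    have hgx : g.symm.symm x = g₀ x := rfl
    rw [hgx]
    have h1 := Circle.coe_ne_zero (δ₂ (g₀ x))
    have h2 := Circle.coe_ne_zero (δ₁ (τ.symm (f x)))
    field_simp
  have := cnotCost_le (k := P + Q + R) himpl (by
    rw [QCircuit.cnotCount_append, QCircuit.cnotCount_append, QCircuit.cnotCount_append,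
      QCircuit.cnotCount_relabel, QCircuit.cnotCount_relabel, QCircuit.cnotCount_inv, hX]
    omega)
  exact_mod_cast this

theorem natCeil_half_sub_one (m : ℕ) : ⌈(m : ℚ) / 2 - 1⌉₊ = (m + 1) / 2 - 1 := by
  refine eq_of_forall_ge_iff fun k => ?_
  rw [Nat.ceil_le, Nat.sub_le_iff_le_add, Nat.div_le_iff_le_mul_add_pred (by norm_num)]
  constructor
  · intro h
    have : (m : ℚ) ≤ 2 * (k + 1) := by linarith
    have : m ≤ 2 * (k + 1) := by exact_mod_cast this
    omega
  · intro h
    have : m ≤ 2 * (k + 1) := by omega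
    have : (m : ℚ) ≤ 2 * (k + 1) := by exact_mod_cast this
    linarith

end Decomposition

theorem mainTheorem9 (n m : ℕ) (hmn : m ≤ n) :
    -- the general bound, for `c` clean and `d` dirty ancillas; the gates on `m` qubits can also
    -- use the remaining `n - m` system qubits, which are then in the state `|0⟩`
    (∀ c d : ℕ, costPermDiagIsometry c d n m ≤
      costPivUpToDiag c d hmn + costPermUpToDiag (c + (n - m)) d m
        + costDiag (c + (n - m)) d m) ∧
    -- no ancilla, except for one dirty ancilla if `m = n - 1`
    (1 ≤ m → ∃ N : ℕ, costPermDiagIsometry 0 (if m + 1 = n then 1 else 0) n m = (N : ℕ∞) ∧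
      (N : ℤ) ≤ ((n : ℤ) + 34 * (m : ℤ) - 34) * 2 ^ m) ∧
    -- `⌈m / 2 - 1⌉` clean ancillas
    (2 ≤ m → ∃ N : ℕ, costPermDiagIsometry ⌈(m : ℚ) / 2 - 1⌉₊ 0 n m = (N : ℕ∞) ∧
      (N : ℤ) ≤ ((n : ℤ) + 24 * (m : ℤ) - 32) * 2 ^ m) := by
  refine ⟨fun c d => iSup₂_le fun σ δ => cnotCost_permDiagIsometry_le hmn c d σ δ,
    fun hm => costPermDiagIsometry_le_no_clean _ hm hmn,
    fun hm => costPermDiagIsometry_le_clean _ hm hmn ?_⟩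
  rw [natCeil_half_sub_one]
  omega
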